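/- Let $p$ be the dimension and let $v_x,v_y>0$ be known. For $\mu\in\mathbb R^p$ let $p(x|\mu)$ and $p(y|\mu)$ denote the densities of $X\sim N_p(\mu,v_xI)$ and $Y\sim N_p(\mu,v_yI)$, where $X$ and $Y$ are independent. Having observed only $X=x$, one chooses a probability density $g$ on $\mathbb R^p$ as an estimate of the density $p(\cdot|\mu)$ of $Y$. The loss is $$L(\mu,g)=\int p(y|\mu)\log\frac{p(y|\mu)}{g(y)}\,dy\ \text{ if } g>0 \text{ a.e.},\qquad L(\mu,g)=\infty\ \text{ otherwise.}$$ A (possibly randomized) procedure $\delta$ assigns to each $x$, measurably in $x$, a probability distribution $\delta(\cdot|x)$ on the set of probability densities on $\mathbb R^p$; it is nonrandomized if it chooses one density $\hat p(\cdot|x)$ for each $x$. Its risk is $R(\mu,\delta)=\int\!\int L(\mu,g)\,\delta(dg|x)\,p(x|\mu)\,dx\in[0,\infty]$. A procedure $\delta_1$ dominates $\delta_2$ if $R(\mu,\delta_1)\le R(\mu,\delta_2)$ for all $\mu$, with strict inequality for some $\mu$; a procedure is admissible if no procedure dominates it. A class of procedures is complete if every procedure outside the class is dominated by a procedure in the class.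 Densities that agree almost everywhere are identified. A (possibly improper) prior is a nonzero, nonnegative, locally finite measure $M$ on $\mathbb R^p$ with $\int p(x|\mu)\,M(d\mu)<\infty$ for all $x$. A procedure is generalized Bayes if there is such an $M$ for which, for almost every $x$, the procedure chooses (with probability one) the density $$\hat p_M(y|x)=\frac{\int p(x|\mu)\,p(y|\mu)\,M(d\mu)}{\int p(x|\mu)\,M(d\mu)}.$$ **Theorem.** The set of all generalized Bayes procedures is a complete class of procedures. In particular, every admissible procedure is generalized Bayes: there is a prior $M$ such that, for almost every $x$, the procedure chooses $\hat p_M(\cdot|x)$. Both assertions hold among all (possibly randomized) procedures, and also when only nonrandomized procedures are considered and compared. -/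

import Mathlib

open MeasureTheory ProbabilityTheory
open scoped ENNReal

noncomputable section

namespace PredictiveDensity

/-- The space `R^p` with the Euclidean norm and Lebesgue measure. -/
abbrev Space (p : ℕ) : Type := EuclideanSpace ℝ (Fin p)

/-- The density of `N_p(μ, v I)` at the point `z`. -/
def normalDensity {p : ℕ} (v : ℝ) (μ z : Space p) : ℝ :=
  (2 * Real.pi * v) ^ (-(p : ℝ) / 2) * Real.exp (-(‖z - μ‖ ^ 2 / (2 * v)))

/-- The action space: all proper (Borel) probability densities on `R^p`. -/
structure Density (p : ℕ) where
  toFun : Space p → ℝ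
  measurable_toFun : Measurable toFun
  nonneg : ∀ y, 0 ≤ toFun y
  lintegral_eq_one : ∫⁻ y, ENNReal.ofReal (toFun y) = 1

instance (p : ℕ) : CoeFun (Density p) (fun _ => Space p → ℝ) := ⟨Density.toFun⟩

/-- The sigma-algebra on the action space generated by the maps `g ↦ ∫_B g(y) dy`, `B` Borel.
It is the Borel sigma-algebra of the `L¹` distance between densities. -/
instance (p : ℕ) : MeasurableSpace (Density p) :=
  MeasurableSpace.comap
    (fun g : Density p => (volume : Measure (Space p)).withDensity fun y => ENNReal.ofReal (g y))
    inferInstance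

open scoped Classical in
/-- Kullback-Leibler loss `L(μ, g) = ∫ p(y|μ) log (p(y|μ) / g(y)) dy` if `g > 0` a.e., and `∞`
otherwise. The negative part of the integrand is at most `g(y)`, hence integrable, and the integral
is nonnegative; so if the integrand is not integrable, then its integral is `∞`. -/
def klLoss {p : ℕ} (vy : ℝ) (μ : Space p) (g : Density p) : ℝ≥0∞ :=
  if (∀ᵐ y, 0 < g y) ∧
      Integrable (fun y => normalDensity vy μ y * Real.log (normalDensity vy μ y / g y)) then
    ENNReal.ofReal (∫ y, normalDensity vy μ y * Real.log (normalDensity vy μ y / g y))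
  else ∞

/-- A (possibly randomized) decision procedure: to every observation `x` it assigns, measurably
in `x`, a probability distribution on the action space. -/
structure Procedure (p : ℕ) where
  kernel : Kernel (Space p) (Density p)
  isMarkov : IsMarkovKernel kernel

/-- The nonrandomized procedure that chooses the density `f x = p̂(·|x)` when `x` is observed. -/
def Procedure.ofFun {p : ℕ} (f : Space p → Density p) (hf : Measurable f) : Procedure p where
  kernel := Kernel.deterministic f hf
  isMarkov := inferInstance

/-- The set of nonrandomized procedures. -/
def nonrandomized (p : ℕ) : Set (Procedure p) :=
  {δ | ∃ (f : Space p → Density p) (hf : Measurable f), δ = Procedure.ofFun f hf}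

/-- The risk of a procedure at `μ`: the expected loss when `X ~ N_p(μ, vx I)`. -/
def risk {p : ℕ} (vx vy : ℝ) (μ : Space p) (δ : Procedure p) : ℝ≥0∞ :=
  ∫⁻ x, (∫⁻ g, klLoss vy μ g ∂(δ.kernel x)) * ENNReal.ofReal (normalDensity vx μ x)

/-- `δ₁` dominates `δ₂`. -/
def Dominates {p : ℕ} (vx vy : ℝ) (δ₁ δ₂ : Procedure p) : Prop :=
  (∀ μ, risk vx vy μ δ₁ ≤ risk vx vy μ δ₂) ∧ ∃ μ, risk vx vy μ δ₁ < risk vx vy μ δ₂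

/-- `δ` belongs to the class `D` of procedures and is not dominated by any procedure in `D`. -/
def IsAdmissible {p : ℕ} (vx vy : ℝ) (D : Set (Procedure p)) (δ : Procedure p) : Prop :=
  δ ∈ D ∧ ∀ δ' ∈ D, ¬ Dominates vx vy δ' δ

/-- `C` is a complete class among the procedures in `D`: every procedure of `D` outside `C` is
dominated by a procedure in `C`. -/
def IsCompleteClass {p : ℕ} (vx vy : ℝ) (D C : Set (Procedure p)) : Prop :=
  C ⊆ D ∧ ∀ δ ∈ D, δ ∉ C → ∃ δ' ∈ C, Dominates vx vy δ' δ

/-- A (possibly improper) prior: a nonzero, locally finite measure `M` on `R^p` for which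
`∫ p(x|μ) M(dμ)` is finite for all `x`. -/
structure IsPrior {p : ℕ} (vx : ℝ) (M : Measure (Space p)) : Prop where
  locallyFinite : IsLocallyFiniteMeasure M
  ne_zero : M ≠ 0
  marginal_lt_top : ∀ x, ∫⁻ μ, ENNReal.ofReal (normalDensity vx μ x) ∂M < ∞

/-- The (formal) Bayes predictive density `p̂_M(y|x)`. -/
def bayesDensity {p : ℕ} (vx vy : ℝ) (M : Measure (Space p)) (x y : Space p) : ℝ :=
  (∫ μ, normalDensity vx μ x * normalDensity vy μ y ∂M) / ∫ μ, normalDensity vx μ x ∂M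

/-- The generalized Bayes procedures: for some prior `M` and almost every `x`, the procedure chooses
(with probability one) the density `p̂_M(·|x)`. Densities that agree a.e. are identified. -/
def generalizedBayes (p : ℕ) (vx vy : ℝ) : Set (Procedure p) :=
  {δ | ∃ M : Measure (Space p), IsPrior vx M ∧
    ∀ᵐ x, ∀ᵐ g ∂(δ.kernel x), ∀ᵐ y, g y = bayesDensity vx vy M x y}

end PredictiveDensity

end

/-!
Every procedure `δ` that is not generalized Bayes is dominated by a nonrandomized generalized Bayes
procedure (`exists_generalizedBayes_dominates`); the complete class and the admissibility assertions
are consequences.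

*Finitely many parameters.* The Bayes procedure for a prior minimises the average risk under that
prior, pointwise in the observation (`sum_lintegral_mixDensity_le`). Consider the game in which
nature picks one of finitely many parameters `θ` and the statistician pays the excess of the risk at
`θ` over the risk of `δ`. Its value is at most zero, so at weights that maximise the Bayes value the
Bayes procedure improves on `δ` at every one of these parameters
(`exists_mem_stdSimplex_forall_le`).

*Passage to the limit.* Take finite sets of parameters that exhaust a countable set over which the
graph of the (finite) risk of `δ` is dense. The resulting priors are compared through their posteriors `P` at
the observation `0`: the posterior at `x` is the exponential tilt of `P` by `⟪x, ·⟫ / vx`. A bound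
on the risk at one parameter keeps the predictive densities away from zero at many points, and this
bounds the Laplace transforms of the `P` at every point (`exists_integral_exp_le`). By
Prokhorov's theorem a subsequence converges together with its Laplace transforms, so the predictive
densities converge pointwise to those of a generalized Bayes procedure
(`exists_subseq_tendsto_tiltDensity`). Fatou's lemma, first along the sequence and then along the
dense set of parameters, shows that the limit has risk at most that of `δ` everywhere
(`exists_tiltDensity_predRisk_le`). The prior is recovered from the posterior `Q` as
`exp (‖μ‖² / (2 vx)) Q(dμ)` (`untilt`).

*Strict improvement.* If the limit has the same risk as `δ`, the argument is applied to the average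
of the two actions. Its risk is strictly smaller somewhere, since the loss is strictly convex and
`δ` differs from every generalized Bayes procedure (`midpoint_risk`).

The loss is written throughout as the lower Lebesgue integral of a nonnegative integrand, `klPoint`,
so that no integrability questions arise.
-/

noncomputable section

namespace PredictiveDensity

open Filter Topology

/-! ### The normal density -/

section Normal

variable {p : ℕ} {v : ℝ}

lemma normalDensity_pos (hv : 0 < v) (μ z : Space p) : 0 < normalDensity v μ z := by
  unfold normalDensity
  have : 0 < 2 * Real.pi * v := by positivity
  positivity

@[fun_prop]
lemma measurable_normalDensity_comp {α : Type*} [MeasurableSpace α] (v : ℝ) {f g : α → Space p}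
    (hf : Measurable f) (hg : Measurable g) : Measurable fun a => normalDensity v (f a) (g a) := by
  unfold normalDensity
  fun_prop

@[fun_prop]
lemma continuous_normalDensity_comp {α : Type*} [TopologicalSpace α] (v : ℝ) {f g : α → Space p}
    (hf : Continuous f) (hg : Continuous g) : Continuous fun a => normalDensity v (f a) (g a) := by
  unfold normalDensity
  fun_prop

lemma integral_normalDensity (hv : 0 < v) (μ : Space p) : ∫ y, normalDensity v μ y = 1 := by
  unfold normalDensity
  rw [integral_const_mul]
  have h1 : ∫ y : Space p, Real.exp (-(‖y - μ‖ ^ 2 / (2 * v)))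
      = ∫ y : Space p, Real.exp (-(1 / (2 * v)) * ‖y‖ ^ 2) := by
    rw [← integral_sub_right_eq_self (fun y : Space p => Real.exp (-(1 / (2 * v)) * ‖y‖ ^ 2)) μ]
    congr 1
    ext y
    congr 1
    ring
  rw [h1, GaussianFourier.integral_rexp_neg_mul_sq_norm (by positivity)]
  have h2 : Real.pi / (1 / (2 * v)) = 2 * Real.pi * v := by field_simp
  rw [h2, finrank_euclideanSpace, Fintype.card_fin, ← Real.rpow_add (by positivity)]
  ring_nf
  simp

lemma integrable_normalDensity (hv : 0 < v) (μ : Space p) :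
    Integrable fun y => normalDensity v μ y := by
  by_contra h
  have := integral_normalDensity hv μ
  rw [integral_undef h] at this
  exact zero_ne_one this

lemma lintegral_normalDensity (hv : 0 < v) (μ : Space p) :
    ∫⁻ y, ENNReal.ofReal (normalDensity v μ y) = 1 := by
  rw [← ofReal_integral_eq_lintegral_ofReal (integrable_normalDensity hv μ)
    (ae_of_all _ fun y => (normalDensity_pos hv μ y).le), integral_normalDensity hv]
  simp

end Normal

/-! ### The pointwise Kullback-Leibler loss -/

/-- The nonnegative integrand `a log (a / g) - a + g` of the Kullback-Leibler loss, equal to `∞`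
where `g ≤ 0`. The correction `g - a` integrates to zero when `a` and `g` are values of probability
densities; it makes the integrand nonnegative, so that the loss becomes a lower Lebesgue integral.
-/
def klPoint (a g : ℝ) : ℝ≥0∞ :=
  if 0 < g then ENNReal.ofReal (a * Real.log (a / g) - a + g) else ∞

lemma klPoint_of_pos {a g : ℝ} (hg : 0 < g) :
    klPoint a g = ENNReal.ofReal (a * Real.log (a / g) - a + g) := if_pos hg

lemma klPoint_of_nonpos {a g : ℝ} (hg : g ≤ 0) : klPoint a g = ∞ := if_neg hg.not_gt

lemma measurable_klPoint : Measurable fun q : ℝ × ℝ => klPoint q.1 q.2 := by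
  unfold klPoint
  refine Measurable.ite (measurableSet_lt measurable_const measurable_snd) ?_ measurable_const
  fun_prop

@[fun_prop]
lemma measurable_klPoint_comp {α : Type*} [MeasurableSpace α] {f g : α → ℝ}
    (hf : Measurable f) (hg : Measurable g) : Measurable fun a => klPoint (f a) (g a) :=
  measurable_klPoint.comp (hf.prodMk hg)

lemma mul_log_div_nonneg {a g : ℝ} (ha : 0 < a) (hg : 0 < g) :
    0 ≤ a * Real.log (a / g) - a + g := by
  have h := Real.one_sub_inv_le_log_of_pos (div_pos ha hg)
  have h2 := mul_le_mul_of_nonneg_left h ha.le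
  have h3 : a * (1 - (a / g)⁻¹) = a - g := by field_simp
  linarith

lemma klPoint_self {a : ℝ} (ha : 0 < a) : klPoint a a = 0 := by
  rw [klPoint_of_pos ha]
  simp [ha.ne']

lemma tendsto_klPoint {α : Type*} {l : Filter α} {a g : α → ℝ} {a₀ g₀ : ℝ}
    (ha : Tendsto a l (𝓝 a₀)) (hg : Tendsto g l (𝓝 g₀)) (ha₀ : 0 < a₀) (hg₀ : 0 < g₀) :
    Tendsto (fun i => klPoint (a i) (g i)) l (𝓝 (klPoint a₀ g₀)) := by
  rw [klPoint_of_pos hg₀]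
  have h : Tendsto (fun i => ENNReal.ofReal (a i * Real.log (a i / g i) - a i + g i)) l
      (𝓝 (ENNReal.ofReal (a₀ * Real.log (a₀ / g₀) - a₀ + g₀))) :=
    ENNReal.tendsto_ofReal
      (((ha.mul ((ha.div hg hg₀.ne').log (div_pos ha₀ hg₀).ne')).sub ha).add hg)
  refine h.congr' ?_
  filter_upwards [hg.eventually (lt_mem_nhds hg₀)] with i hi
  rw [klPoint_of_pos hi]

/-- Among all constants `g`, the weighted mean of the `a j` minimises the weighted sum of the
losses; the excess of any other `g` is the total weight times the loss of `g` against the mean. -/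
lemma sum_klPoint_mean_le {ι : Type*} [Fintype ι] (w a : ι → ℝ) (hw : ∀ j, 0 ≤ w j)
    (ha : ∀ j, 0 < a j) (hW : 0 < ∑ j, w j) (g : ℝ) :
    ∑ j, ENNReal.ofReal (w j) * klPoint (a j) ((∑ k, w k * a k) / ∑ k, w k)
      ≤ ∑ j, ENNReal.ofReal (w j) * klPoint (a j) g := by
  obtain ⟨i, -, hi⟩ : ∃ i ∈ Finset.univ, 0 < w i := by
    by_contra! h
    exact hW.not_ge (Finset.sum_nonpos h)
  set m := (∑ k, w k * a k) / ∑ k, w k with hm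
  have hm0 : 0 < m := div_pos (Finset.sum_pos' (fun j _ => mul_nonneg (hw j) (ha j).le)
    ⟨i, Finset.mem_univ i, mul_pos hi (ha i)⟩) hW
  rcases le_or_gt g 0 with hg | hg
  · refine le_top.trans_eq (Eq.symm ?_)
    rw [ENNReal.sum_eq_top]
    exact ⟨i, Finset.mem_univ i, by rw [klPoint_of_nonpos hg, ENNReal.mul_top (by simpa using hi)]⟩
  have key : ∀ b : ℝ, 0 < b → ∑ j, ENNReal.ofReal (w j) * klPoint (a j) b
      = ENNReal.ofReal (∑ j, w j * (a j * Real.log (a j / b) - a j + b)) := by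
    intro b hb
    rw [ENNReal.ofReal_sum_of_nonneg
      fun j _ => mul_nonneg (hw j) (mul_log_div_nonneg (ha j) hb)]
    exact Finset.sum_congr rfl fun j _ => by rw [klPoint_of_pos hb, ENNReal.ofReal_mul (hw j)]
  rw [key m hm0, key g hg]
  refine ENNReal.ofReal_le_ofReal ?_
  have hmW : (∑ k, w k * a k) = (∑ k, w k) * m := by rw [hm]; field_simp
  have h0 : 0 ≤ (∑ k, w k) * (m * Real.log (m / g) - m + g) :=
    mul_nonneg hW.le (mul_log_div_nonneg hm0 hg)
  have h1 : ∑ j, w j * (a j * Real.log (a j / g) - a j + g)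
      - ∑ j, w j * (a j * Real.log (a j / m) - a j + m)
      = (∑ k, w k * a k) * Real.log (m / g) + (∑ k, w k) * (g - m) := by
    rw [← Finset.sum_sub_distrib, Finset.sum_mul, Finset.sum_mul, ← Finset.sum_add_distrib]
    refine Finset.sum_congr rfl fun j _ => ?_
    rw [Real.log_div (ha j).ne' hg.ne', Real.log_div (ha j).ne' hm0.ne',
      Real.log_div hm0.ne' hg.ne']
    ring
  rw [hmW] at h1
  nlinarith

/-- Strict midpoint convexity of `g ↦ a log (a / g) - a + g`. -/
lemma mul_log_div_midpoint {a g f : ℝ} (ha : 0 < a) (hg : 0 < g) (hf : 0 < f) :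
    a * Real.log (a / ((g + f) / 2)) - a + (g + f) / 2
      ≤ ((a * Real.log (a / g) - a + g) + (a * Real.log (a / f) - a + f)) / 2 ∧
    (a * Real.log (a / ((g + f) / 2)) - a + (g + f) / 2
      = ((a * Real.log (a / g) - a + g) + (a * Real.log (a / f) - a + f)) / 2 → g = f) := by
  have hs : 0 < (g + f) / 2 := by positivity
  rw [Real.log_div ha.ne' hg.ne', Real.log_div ha.ne' hf.ne', Real.log_div ha.ne' hs.ne']
  have hlt : g ≠ f → Real.log g / 2 + Real.log f / 2 < Real.log ((g + f) / 2) := by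
    intro hne
    have := strictConcaveOn_log_Ioi.2 (Set.mem_Ioi.2 hg) (Set.mem_Ioi.2 hf) hne
      (by norm_num : (0 : ℝ) < 1 / 2) (by norm_num : (0 : ℝ) < 1 / 2) (by norm_num)
    simp only [smul_eq_mul] at this
    rw [show (g + f) / 2 = 1 / 2 * g + 1 / 2 * f by ring]
    linarith
  refine ⟨?_, fun h => ?_⟩
  · rcases eq_or_ne g f with rfl | hne
    · have : (g + g) / 2 = g := by ring
      rw [this]
      linarith
    · nlinarith [hlt hne]
  · by_contra hne
    nlinarith [hlt hne]

lemma klPoint_midpoint_le {a g f : ℝ} (ha : 0 < a) (hf : 0 < f) :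
    klPoint a ((g + f) / 2) ≤ (klPoint a g + klPoint a f) / 2 := by
  rcases le_or_gt g 0 with hg | hg
  · rw [klPoint_of_nonpos hg]
    simp [ENNReal.top_div]
  · rw [klPoint_of_pos hg, klPoint_of_pos hf, klPoint_of_pos (by positivity),
      ← ENNReal.ofReal_add (mul_log_div_nonneg ha hg) (mul_log_div_nonneg ha hf)]
    rw [show (2 : ℝ≥0∞) = ENNReal.ofReal 2 by simp, ← ENNReal.ofReal_div_of_pos two_pos]
    exact ENNReal.ofReal_le_ofReal (mul_log_div_midpoint ha hg hf).1

lemma eq_of_klPoint_midpoint_eq {a g f : ℝ} (ha : 0 < a) (hg : 0 ≤ g) (hf : 0 < f)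
    (h : klPoint a ((g + f) / 2) = (klPoint a g + klPoint a f) / 2) : g = f := by
  have hs : 0 < (g + f) / 2 := by positivity
  rcases hg.eq_or_lt with rfl | hg
  · rw [klPoint_of_pos hs, klPoint_of_nonpos le_rfl] at h
    simp [ENNReal.top_div] at h
  · rw [klPoint_of_pos hg, klPoint_of_pos hf, klPoint_of_pos hs,
      ← ENNReal.ofReal_add (mul_log_div_nonneg ha hg) (mul_log_div_nonneg ha hf),
      show (2 : ℝ≥0∞) = ENNReal.ofReal 2 by simp, ← ENNReal.ofReal_div_of_pos two_pos,
      ENNReal.ofReal_eq_ofReal_iff (mul_log_div_nonneg ha hs)] at h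
    · exact (mul_log_div_midpoint ha hg hf).2 h
    · have := mul_log_div_nonneg ha hg
      have := mul_log_div_nonneg ha hf
      positivity

/-- A bound on the pointwise loss bounds `g` away from zero. -/
lemma le_of_klPoint_le {a g K : ℝ} (ha : 0 < a) (hK : 0 ≤ K)
    (h : klPoint a g ≤ ENNReal.ofReal K) : a * Real.exp (-(1 + K / a)) ≤ g := by
  rcases le_or_gt g 0 with hg | hg
  · rw [klPoint_of_nonpos hg] at h
    simp at h
  rw [klPoint_of_pos hg, ENNReal.ofReal_le_ofReal_iff hK] at h
  have h1 : Real.log (a / g) ≤ 1 + K / a := by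
    rw [← sub_le_iff_le_add', le_div_iff₀ ha]
    nlinarith
  have h2 : a / g ≤ Real.exp (1 + K / a) := (Real.log_le_iff_le_exp (div_pos ha hg)).1 h1
  rw [Real.exp_neg, ← div_eq_mul_inv, div_le_iff₀ (Real.exp_pos _)]
  rwa [div_le_iff₀' hg] at h2

lemma Density.integrable {p : ℕ} (g : Density p) : Integrable g := by
  refine ⟨g.measurable_toFun.aestronglyMeasurable, ?_⟩
  rw [hasFiniteIntegral_iff_ofReal (ae_of_all _ g.nonneg), g.lintegral_eq_one]
  exact ENNReal.one_lt_top

lemma Density.integral_eq_one {p : ℕ} (g : Density p) : ∫ y, g y = 1 := by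
  rw [integral_eq_lintegral_of_nonneg_ae (ae_of_all _ g.nonneg)
    g.measurable_toFun.aestronglyMeasurable, g.lintegral_eq_one]
  simp

lemma klLoss_eq_lintegral {p : ℕ} {vy : ℝ} (hvy : 0 < vy) (μ : Space p) (g : Density p) :
    klLoss vy μ g = ∫⁻ y, klPoint (normalDensity vy μ y) (g y) := by
  classical
  have hN := integrable_normalDensity hvy μ
  by_cases hg : ∀ᵐ y, 0 < g y
  · have h1 : ∫⁻ y, klPoint (normalDensity vy μ y) (g y) = ∫⁻ y, ENNReal.ofReal
        (normalDensity vy μ y * Real.log (normalDensity vy μ y / g y)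
          - normalDensity vy μ y + g y) :=
      lintegral_congr_ae (hg.mono fun y hy => klPoint_of_pos hy)
    have hnn : 0 ≤ᵐ[volume] fun y => normalDensity vy μ y *
        Real.log (normalDensity vy μ y / g y) - normalDensity vy μ y + g y :=
      hg.mono fun y hy => mul_log_div_nonneg (normalDensity_pos hvy μ y) hy
    have hmeas : Measurable fun y => normalDensity vy μ y *
        Real.log (normalDensity vy μ y / g y) - normalDensity vy μ y + g y := by
      have hm := measurable_normalDensity_comp vy (measurable_const (a := μ)) measurable_id'
      exact ((hm.mul (Real.measurable_log.comp (hm.div g.measurable_toFun))).sub hm).add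
        g.measurable_toFun
    by_cases hi : Integrable fun y => normalDensity vy μ y * Real.log (normalDensity vy μ y / g y)
    · have h3 := ofReal_integral_eq_lintegral_ofReal ((hi.sub hN).add g.integrable) hnn
      have h4 := integral_add (hi.sub hN) g.integrable
      rw [integral_sub' hi hN, integral_normalDensity hvy, g.integral_eq_one,
        sub_add_cancel] at h4
      rw [klLoss, if_pos ⟨hg, hi⟩, h1, ← h4]
      exact h3
    · rw [klLoss, if_neg (fun h => hi h.2), h1]
      by_contra hne
      refine hi ?_
      have h2 : Integrable fun y => normalDensity vy μ y *
          Real.log (normalDensity vy μ y / g y) - normalDensity vy μ y + g y := by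
        refine ⟨hmeas.aestronglyMeasurable, ?_⟩
        rw [hasFiniteIntegral_iff_ofReal hnn]
        exact lt_top_iff_ne_top.2 (Ne.symm hne)
      refine ((h2.sub g.integrable).add hN).congr (ae_of_all _ fun y => ?_)
      simp
  · rw [klLoss, if_neg (fun h => hg h.1)]
    symm
    have hm : Measurable fun y => klPoint (normalDensity vy μ y) (g y) :=
      measurable_klPoint_comp
        (measurable_normalDensity_comp vy measurable_const measurable_id') g.measurable_toFun
    by_contra hne
    refine hg ((ae_lt_top hm hne).mono fun y hy => ?_)
    by_contra h
    rw [klPoint_of_nonpos (not_lt.1 h)] at hy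
    exact lt_irrefl _ hy

/-! ### A finite game -/

/-- Let `r π` be the risk vector of a procedure that is Bayes for the weights `π` on finitely many
parameters, lower semicontinuous in `π`, and let `c` be a finite vector whose average under every
`π` is at least the Bayes risk. Then some Bayes procedure has a risk vector below `c`. -/
theorem exists_mem_stdSimplex_forall_le {ι : Type*} [Fintype ι] [Nonempty ι]
    (r : (ι → ℝ) → ι → ℝ≥0∞) (c : ι → ℝ≥0∞) (hc : ∀ i, c i ≠ ∞)
    (hopt : ∀ π ∈ stdSimplex ℝ ι, ∀ π' ∈ stdSimplex ℝ ι,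
      ∑ j, ENNReal.ofReal (π j) * r π j ≤ ∑ j, ENNReal.ofReal (π j) * r π' j)
    (hle : ∀ π ∈ stdSimplex ℝ ι,
      ∑ j, ENNReal.ofReal (π j) * r π j ≤ ∑ j, ENNReal.ofReal (π j) * c j)
    (hlsc : ∀ i, ∀ π ∈ stdSimplex ℝ ι, ∀ u : ℕ → ι → ℝ, (∀ n, u n ∈ stdSimplex ℝ ι) →
      Tendsto u atTop (𝓝 π) → r π i ≤ liminf (fun n => r (u n) i) atTop) :
    ∃ π ∈ stdSimplex ℝ ι, ∀ i, r π i ≤ c i := by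
  classical
  have hsum (π : ι → ℝ) (hπ : π ∈ stdSimplex ℝ ι) (f : ι → ℝ≥0∞) (hf : ∀ j, f j ≠ ∞) :
      ∑ j, ENNReal.ofReal (π j) * f j = ENNReal.ofReal (∑ j, π j * (f j).toReal) := by
    rw [ENNReal.ofReal_sum_of_nonneg fun j _ => mul_nonneg (hπ.1 j) ENNReal.toReal_nonneg]
    exact Finset.sum_congr rfl fun j _ => by
      rw [ENNReal.ofReal_mul (hπ.1 j), ENNReal.ofReal_toReal (hf j)]
  have hnn (π : ι → ℝ) (hπ : π ∈ stdSimplex ℝ ι) (f : ι → ℝ≥0∞) :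
      0 ≤ ∑ j, π j * (f j).toReal :=
    Finset.sum_nonneg fun j _ => mul_nonneg (hπ.1 j) ENNReal.toReal_nonneg
  set C : ℝ := ∑ j, (c j).toReal with hC
  have hC0 : 0 ≤ C := Finset.sum_nonneg fun j _ => ENNReal.toReal_nonneg
  have hcC (π : ι → ℝ) (hπ : π ∈ stdSimplex ℝ ι) : ∑ j, π j * (c j).toReal ≤ C := by
    refine Finset.sum_le_sum fun j _ => mul_le_of_le_one_left ENNReal.toReal_nonneg ?_
    rw [← hπ.2]
    exact Finset.single_le_sum (fun k _ => hπ.1 k) (Finset.mem_univ j)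
  -- The risk vectors are finite at interior weights.
  let I : Set (ι → ℝ) := {π | π ∈ stdSimplex ℝ ι ∧ ∀ j, 0 < π j}
  have hfin (π : ι → ℝ) (hπ : π ∈ I) (j : ι) : r π j ≠ ∞ := by
    intro h
    have h1 := hle π hπ.1
    rw [hsum π hπ.1 c hc] at h1
    have h2 := (ENNReal.sum_lt_top.1 (h1.trans_lt ENNReal.ofReal_lt_top)) j (Finset.mem_univ j)
    rw [h, ENNReal.mul_top (by simpa using hπ.2 j)] at h2
    exact lt_irrefl _ h2
  let u : ι → ℝ := fun _ => (Fintype.card ι : ℝ)⁻¹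
  have hcard : (0 : ℝ) < Fintype.card ι := by exact_mod_cast Fintype.card_pos
  have hu : u ∈ I := by
    refine ⟨⟨fun j => by positivity, ?_⟩, fun j => by positivity⟩
    simp [u, hcard.ne']
  have : Nonempty I := ⟨⟨u, hu⟩⟩
  let F : I → (ι → ℝ) → ℝ := fun π' π => ∑ j, π j * ((r π' j).toReal - (c j).toReal)
  have hF (π' : I) (π : ι → ℝ) :
      F π' π = ∑ j, π j * (r π' j).toReal - ∑ j, π j * (c j).toReal := by
    simp only [F, mul_sub, Finset.sum_sub_distrib]
  have hbdd : ∀ π ∈ stdSimplex ℝ ι, BddBelow (Set.range fun π' => F π' π) := by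
    rintro π hπ
    refine ⟨-C, ?_⟩
    rintro _ ⟨π', rfl⟩
    have := hnn π hπ (r π')
    have := hcC π hπ
    simp only [hF]
    linarith
  have husc : UpperSemicontinuousOn (fun π => ⨅ π', F π' π) (stdSimplex ℝ ι) := by
    refine upperSemicontinuousOn_ciInf hbdd fun π' => ?_
    refine (Continuous.upperSemicontinuous ?_).upperSemicontinuousOn _
    fun_prop
  obtain ⟨π, hπ, hmax⟩ := husc.exists_isMaxOn ⟨u, hu.1⟩ (isCompact_stdSimplex ℝ ι)
  refine ⟨π, hπ, fun i => ?_⟩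
  -- Perturb the maximiser towards the vertex `i`, staying in the interior.
  let t : ℕ → ℝ := fun n => 1 / ((n : ℝ) + 2)
  have ht0 (n : ℕ) : 0 < t n := by positivity
  have ht1 (n : ℕ) : t n < 1 := by
    simp only [t]
    rw [div_lt_one (by positivity)]
    have : (0 : ℝ) ≤ n := n.cast_nonneg
    linarith
  have htlim : Tendsto t atTop (𝓝 0) := by
    refine Tendsto.div_atTop tendsto_const_nhds ?_
    exact tendsto_atTop_add_const_right _ _ tendsto_natCast_atTop_atTop
  let q : ℕ → ι → ℝ := fun n j => (1 - t n) * Pi.single (M := fun _ => ℝ) i 1 j + t n * u j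
  have hsingle : (Pi.single i 1 : ι → ℝ) ∈ stdSimplex ℝ ι := single_mem_stdSimplex ℝ i
  have hq (n : ℕ) : q n ∈ I := by
    refine ⟨?_, fun j => ?_⟩
    · exact convex_stdSimplex ℝ ι hsingle hu.1 (by linarith [ht1 n]) (ht0 n).le (by ring)
    · have h1 := hsingle.1 j
      have h2 := mul_pos (ht0 n) (hu.2 j)
      have h3 := mul_nonneg (sub_nonneg.2 (ht1 n).le) h1
      simp only [q]
      linarith
  let w : ℕ → ι → ℝ := fun n j => (1 - t n) * π j + t n * q n j
  have hw (n : ℕ) : w n ∈ I := by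
    refine ⟨?_, fun j => ?_⟩
    · exact convex_stdSimplex ℝ ι hπ (hq n).1 (by linarith [ht1 n]) (ht0 n).le (by ring)
    · have h1 := hπ.1 j
      have h2 := mul_pos (ht0 n) ((hq n).2 j)
      have h3 := mul_nonneg (sub_nonneg.2 (ht1 n).le) h1
      simp only [w]
      linarith
  have hwlim : Tendsto w atTop (𝓝 π) := by
    rw [tendsto_pi_nhds]
    intro j
    have h1 : Tendsto (fun n => (1 - t n) * π j
        + t n * ((1 - t n) * Pi.single (M := fun _ => ℝ) i 1 j + t n * u j)) atTop
        (𝓝 ((1 - 0) * π j + 0 * ((1 - 0) * Pi.single (M := fun _ => ℝ) i 1 j + 0 * u j))) := by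
      have h2 := htlim.const_sub 1
      exact (h2.mul_const _).add (htlim.mul ((h2.mul_const _).add (htlim.mul_const _)))
    simpa [w, q] using h1
  have hbound (n : ℕ) : r (w n) i ≤
      ENNReal.ofReal (((c i).toReal + t n * C + t n * C / (1 - t n)) / (1 - t n)) := by
    have h1t : 0 < 1 - t n := by linarith [ht1 n]
    let W : I := ⟨w n, hw n⟩
    -- At interior weights the infimum is attained by the Bayes procedure itself.
    have hA : F W (w n) ≤ ⨅ π', F π' π := by
      refine le_trans (le_ciInf fun π' => ?_) (hmax (hw n).1)
      have := hopt (w n) (hw n).1 π' π'.2.1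
      rw [hsum _ (hw n).1 _ (hfin _ (hw n)), hsum _ (hw n).1 _ (hfin _ π'.2),
        ENNReal.ofReal_le_ofReal_iff (hnn _ (hw n).1 _)] at this
      rw [hF, hF]
      linarith
    have hB : ⨅ π', F π' π ≤ F W π := ciInf_le (hbdd π hπ) W
    have hN : F W (w n) ≤ 0 := by
      have := hle (w n) (hw n).1
      rw [hsum _ (hw n).1 _ (hfin _ (hw n)), hsum _ (hw n).1 _ hc,
        ENNReal.ofReal_le_ofReal_iff (hnn _ (hw n).1 _)] at this
      rw [hF]
      linarith
    have hlin : F W (w n) = (1 - t n) * F W π + t n * F W (q n) := by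
      simp only [F, Finset.mul_sum, ← Finset.sum_add_distrib, w]
      exact Finset.sum_congr rfl fun j _ => by ring
    have hqC : -C ≤ F W (q n) := by
      have h1 := hnn (q n) (hq n).1 (r (w n))
      have h2 := hcC (q n) (hq n).1
      rw [hF]
      linarith
    have hFπ : F W π ≤ t n * C / (1 - t n) := by
      rw [le_div_iff₀ h1t]
      nlinarith [ht0 n]
    have hFq : F W (q n) ≤ F W π := by
      nlinarith [ht0 n, hA.trans hB]
    have hr0 (j : ι) : 0 ≤ (r (w n) j).toReal := ENNReal.toReal_nonneg
    have h3 : (1 - t n) * (r (w n) i).toReal ≤ ∑ j, q n j * (r (w n) j).toReal := by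
      refine le_trans ?_ (Finset.single_le_sum
        (fun j _ => mul_nonneg ((hq n).1.1 j) (hr0 j)) (Finset.mem_univ i))
      refine mul_le_mul_of_nonneg_right ?_ (hr0 i)
      have := mul_pos (ht0 n) (hu.2 i)
      simp only [q, Pi.single_eq_same]
      linarith
    have h4 : ∑ j, q n j * (c j).toReal ≤ (c i).toReal + t n * C := by
      have h5 : ∑ j, q n j * (c j).toReal
          = (1 - t n) * (c i).toReal + t n * ∑ j, u j * (c j).toReal := by
        simp only [q, add_mul, Finset.sum_add_distrib, Finset.mul_sum, mul_assoc]
        congr 1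
        rw [Finset.sum_eq_single i]
        · simp
        · intro j _ hj
          simp [hj]
        · simp
      rw [h5]
      have h6 := mul_le_mul_of_nonneg_left (hcC u hu.1) (ht0 n).le
      have h7 : 0 ≤ t n * (c i).toReal := mul_nonneg (ht0 n).le ENNReal.toReal_nonneg
      linarith
    rw [← ENNReal.ofReal_toReal (hfin _ (hw n) i)]
    refine ENNReal.ofReal_le_ofReal ?_
    rw [le_div_iff₀ h1t, mul_comm]
    have h8 := hF W (q n)
    simp only [W] at h8 hFq hFπ
    linarith
  have hlim : Tendsto (fun n => ENNReal.ofReal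
      (((c i).toReal + t n * C + t n * C / (1 - t n)) / (1 - t n))) atTop (𝓝 (c i)) := by
    have h2 : Tendsto (fun n => 1 - t n) atTop (𝓝 (1 - 0)) := htlim.const_sub 1
    have h3 := (((htlim.mul_const C).const_add (c i).toReal).add
      ((htlim.mul_const C).div h2 (by norm_num))).div h2 (by norm_num)
    have h4 := ENNReal.tendsto_ofReal h3
    simpa [ENNReal.ofReal_toReal (hc i)] using h4
  calc r π i ≤ liminf (fun n => r (w n) i) atTop := hlsc i π hπ w (fun n => (hw n).1) hwlim
    _ ≤ liminf (fun n => ENNReal.ofReal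
        (((c i).toReal + t n * C + t n * C / (1 - t n)) / (1 - t n))) atTop :=
      liminf_le_liminf (Eventually.of_forall hbound)
    _ = c i := hlim.liminf_eq

variable {p : ℕ} {vx vy : ℝ}

/-! ### Predictive densities as mixtures over an exponentially tilted measure -/

/-- The predictive density at `x` that belongs to the posterior `P` at the observation `0`: the
posterior at `x` is proportional to `exp (⟪x, μ⟫ / vx) P(dμ)`. -/
def tiltDensity (vx vy : ℝ) (P : Measure (Space p)) (x y : Space p) : ℝ :=
  (∫ μ, Real.exp (inner ℝ x μ / vx) * normalDensity vy μ y ∂P) /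
    ∫ μ, Real.exp (inner ℝ x μ / vx) ∂P

/-- The Laplace transform of `P` is finite everywhere. -/
def HasExpMoments (vx : ℝ) (P : Measure (Space p)) : Prop :=
  ∀ x : Space p, Integrable (fun μ => Real.exp (inner ℝ x μ / vx)) P

/-- The risk at `θ` of the nonrandomized procedure that chooses `q x` at `x`. -/
def predRisk (vx vy : ℝ) (θ : Space p) (q : Space p → Space p → ℝ) : ℝ≥0∞ :=
  ∫⁻ z : Space p × Space p,
    klPoint (normalDensity vy θ z.2) (q z.1 z.2) * ENNReal.ofReal (normalDensity vx θ z.1)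

lemma predRisk_eq_lintegral {θ : Space p} {q : Space p → Space p → ℝ}
    (hq : Measurable (Function.uncurry q)) : predRisk vx vy θ q = ∫⁻ x,
      (∫⁻ y, klPoint (normalDensity vy θ y) (q x y)) * ENNReal.ofReal (normalDensity vx θ x) := by
  have hH : Measurable fun z : Space p × Space p =>
      klPoint (normalDensity vy θ z.2) (q z.1 z.2) :=
    measurable_klPoint_comp (by fun_prop) hq
  unfold predRisk
  rw [Measure.volume_eq_prod, lintegral_prod]
  · refine lintegral_congr fun x => ?_
    exact lintegral_mul_const (ENNReal.ofReal (normalDensity vx θ x))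
      (f := fun y => klPoint (normalDensity vy θ y) (q x y)) (hH.comp measurable_prodMk_left)
  · have h2 : Measurable fun z : Space p × Space p => normalDensity vx θ z.1 := by fun_prop
    exact (hH.mul h2.ennreal_ofReal).aemeasurable

/-- The exponential tilt does not outgrow the Gaussian factor. -/
lemma exp_mul_normalDensity_le (hvx : 0 < vx) (hvy : 0 < vy) (x y μ : Space p) :
    Real.exp (inner ℝ x μ / vx) * normalDensity vy μ y ≤ (2 * Real.pi * vy) ^ (-(p : ℝ) / 2) *
      Real.exp (‖x‖ * ‖y‖ / vx + vy * ‖x‖ ^ 2 / (2 * vx ^ 2)) := by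
  unfold normalDensity
  have h : 0 < 2 * Real.pi * vy := by positivity
  rw [mul_left_comm, ← Real.exp_add]
  refine mul_le_mul_of_nonneg_left (Real.exp_le_exp.2 ?_) (by positivity)
  have h1 : inner ℝ x μ ≤ ‖x‖ * ‖y‖ + ‖x‖ * ‖y - μ‖ := by
    have : (inner ℝ x μ : ℝ) = inner ℝ x y + inner ℝ x (μ - y) := by
      rw [← inner_add_right]; simp
    rw [this, norm_sub_rev y μ]
    exact add_le_add (real_inner_le_norm _ _) (real_inner_le_norm _ _)
  have h2 : inner ℝ x μ / vx ≤ ‖x‖ * ‖y‖ / vx + ‖x‖ * ‖y - μ‖ / vx := by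
    rw [← add_div]
    gcongr
  have h3 : vy * ‖x‖ ^ 2 / (2 * vx ^ 2) + ‖y - μ‖ ^ 2 / (2 * vy) - ‖x‖ * ‖y - μ‖ / vx
      = (vy * ‖x‖ / vx - ‖y - μ‖) ^ 2 / (2 * vy) := by
    field_simp
    ring
  have h4 : 0 ≤ (vy * ‖x‖ / vx - ‖y - μ‖) ^ 2 / (2 * vy) := by positivity
  linarith

lemma continuous_exp_mul_normalDensity (x y : Space p) :
    Continuous fun μ => Real.exp (inner ℝ x μ / vx) * normalDensity vy μ y := by
  fun_prop

lemma integrable_exp_mul_normalDensity (hvx : 0 < vx) (hvy : 0 < vy) (P : Measure (Space p))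
    [IsFiniteMeasure P] (x y : Space p) :
    Integrable (fun μ => Real.exp (inner ℝ x μ / vx) * normalDensity vy μ y) P := by
  refine Integrable.of_bound (continuous_exp_mul_normalDensity x y).aestronglyMeasurable
    ((2 * Real.pi * vy) ^ (-(p : ℝ) / 2) *
      Real.exp (‖x‖ * ‖y‖ / vx + vy * ‖x‖ ^ 2 / (2 * vx ^ 2))) (ae_of_all P fun μ => ?_)
  rw [Real.norm_of_nonneg (mul_nonneg (Real.exp_pos _).le (normalDensity_pos hvy μ y).le)]
  exact exp_mul_normalDensity_le hvx hvy x y μ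

lemma tiltDensity_pos (hvx : 0 < vx) (hvy : 0 < vy) {P : Measure (Space p)}
    [IsProbabilityMeasure P] (hP : HasExpMoments vx P) (x y : Space p) :
    0 < tiltDensity vx vy P x y := by
  refine div_pos ?_ (integral_exp_pos (hP x))
  have h (μ : Space p) : 0 < Real.exp (inner ℝ x μ / vx) * normalDensity vy μ y :=
    mul_pos (Real.exp_pos _) (normalDensity_pos hvy μ y)
  rw [integral_pos_iff_support_of_nonneg (fun μ => (h μ).le)
    (integrable_exp_mul_normalDensity hvx hvy P x y)]
  rw [Function.support_eq_univ fun μ => (h μ).ne']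
  simp

lemma measurable_tiltDensity (P : Measure (Space p)) [SFinite P] :
    Measurable fun z : Space p × Space p => tiltDensity vx vy P z.1 z.2 := by
  unfold tiltDensity
  refine Measurable.div ?_ ?_
  · have h : StronglyMeasurable fun w : (Space p × Space p) × Space p =>
        Real.exp (inner ℝ w.1.1 w.2 / vx) * normalDensity vy w.2 w.1.2 :=
      Measurable.stronglyMeasurable (by fun_prop)
    exact h.integral_prod_right'.measurable
  · have h : StronglyMeasurable fun w : (Space p × Space p) × Space p =>
        Real.exp (inner ℝ w.1.1 w.2 / vx) :=
      Measurable.stronglyMeasurable (by fun_prop)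
    exact h.integral_prod_right'.measurable

lemma measurable_tiltDensity_right (P : Measure (Space p)) [SFinite P] (x : Space p) :
    Measurable (tiltDensity vx vy P x) := by
  have h : Measurable (Function.uncurry (tiltDensity vx vy P)) := measurable_tiltDensity P
  exact h.of_uncurry_left

/-! ### A risk bound controls the Laplace transform -/

/-- If the risk at one parameter is at most `C`, the Laplace transform of the posterior at `0` is
bounded at every point `z`, uniformly in the posterior. The loss is bounded on average near `z`, so
`z` is the midpoint of two observations at which it is bounded. There the predictive density is
bounded below at some `y`; its numerator is bounded above, so its denominator, the Laplace
transform, is bounded too, and convexity carries the bound to `z`. -/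
lemma exists_integral_exp_le (hvx : 0 < vx) (hvy : 0 < vy) (θ z : Space p) {C : ℝ≥0∞}
    (hC : C ≠ ∞) : ∃ K : ℝ, ∀ P : Measure (Space p), IsProbabilityMeasure P →
      HasExpMoments vx P → predRisk vx vy θ (tiltDensity vx vy P) ≤ C →
      ∫ μ, Real.exp (inner ℝ z μ / vx) ∂P ≤ K := by
  set S : Set (Space p) := Metric.closedBall 0 1 with hS
  set V : ℝ≥0∞ := volume S with hV
  have hV0 : V ≠ 0 := (Metric.measure_closedBall_pos volume 0 one_pos).ne'
  have hVt : V ≠ ∞ := measure_closedBall_lt_top.ne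
  obtain ⟨x₀, -, hx₀⟩ := (isCompact_closedBall z 1).exists_isMinOn
    ⟨z, Metric.mem_closedBall_self zero_le_one⟩
    (f := fun x : Space p => normalDensity vx θ x) (by fun_prop)
  obtain ⟨y₀, -, hy₀⟩ := (isCompact_closedBall (0 : Space p) 1).exists_isMinOn
    ⟨0, Metric.mem_closedBall_self zero_le_one⟩
    (f := fun y : Space p => normalDensity vy θ y) (by fun_prop)
  set b := normalDensity vx θ x₀ with hb
  set a := normalDensity vy θ y₀ with ha
  have hb0 : 0 < b := normalDensity_pos hvx _ _
  have ha0 : 0 < a := normalDensity_pos hvy _ _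
  set K₁ : ℝ≥0∞ := (C / ENNReal.ofReal b + C / ENNReal.ofReal b) / V with hK₁
  have hK₁t : K₁ ≠ ∞ := by
    have : C / ENNReal.ofReal b ≠ ∞ := ENNReal.div_ne_top hC (by simpa using hb0)
    exact ENNReal.div_ne_top (ENNReal.add_ne_top.2 ⟨this, this⟩) hV0
  set K₂ : ℝ := (K₁ / V).toReal with hK₂
  set c : ℝ := a * Real.exp (-(1 + K₂ / a)) with hc
  have hc0 : 0 < c := mul_pos ha0 (Real.exp_pos _)
  set D : ℝ := (2 * Real.pi * vy) ^ (-(p : ℝ) / 2) *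
      Real.exp ((‖z‖ + 1) * 1 / vx + vy * (‖z‖ + 1) ^ 2 / (2 * vx ^ 2)) with hD
  refine ⟨D / c, fun P hP hPm hrisk => ?_⟩
  let H : Space p → Space p → ℝ≥0∞ := fun x y =>
    klPoint (normalDensity vy θ y) (tiltDensity vx vy P x y)
  have hH : Measurable (Function.uncurry H) :=
    measurable_klPoint_comp (by fun_prop) (measurable_tiltDensity P)
  let Φ : Space p → ℝ≥0∞ := fun x => ∫⁻ y in S, H x y
  have hΦ : Measurable Φ := hH.lintegral_prod_right
  have hint : ∫⁻ x, ENNReal.ofReal (normalDensity vx θ x) * Φ x ≤ C := by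
    rw [predRisk_eq_lintegral (measurable_tiltDensity P)] at hrisk
    refine (lintegral_mono fun x => ?_).trans hrisk
    rw [mul_comm]
    gcongr
    exact setLIntegral_le_lintegral _ _
  -- The loss, averaged over a ball of observations around `z`, is bounded.
  have hball (s : Space p → Space p) (hs : Measurable s)
      (hsz : ∀ w ∈ S, s w ∈ Metric.closedBall z 1)
      (hinv : ∀ f : Space p → ℝ≥0∞, ∫⁻ w, f (s w) = ∫⁻ x, f x) :
      ∫⁻ w in S, Φ (s w) ≤ C / ENNReal.ofReal b := by
    rw [ENNReal.le_div_iff_mul_le (Or.inl (by simpa using hb0)) (Or.inl ENNReal.ofReal_ne_top),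
      mul_comm, ← lintegral_const_mul (ENNReal.ofReal b) (f := fun w => Φ (s w)) (hΦ.comp hs)]
    calc ∫⁻ w in S, ENNReal.ofReal b * Φ (s w)
        ≤ ∫⁻ w in S, ENNReal.ofReal (normalDensity vx θ (s w)) * Φ (s w) := by
          refine setLIntegral_mono' measurableSet_closedBall fun w hw => ?_
          gcongr
          exact hx₀ (hsz w hw)
      _ ≤ ∫⁻ w, ENNReal.ofReal (normalDensity vx θ (s w)) * Φ (s w) :=
          setLIntegral_le_lintegral _ _
      _ = ∫⁻ x, ENNReal.ofReal (normalDensity vx θ x) * Φ x :=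
          hinv fun x => ENNReal.ofReal (normalDensity vx θ x) * Φ x
      _ ≤ C := hint
  have hplus := hball (fun w => z + w) (by fun_prop) (fun w hw => by simpa [hS] using hw)
    (fun f => lintegral_add_left_eq_self f z)
  have hminus := hball (fun w => z - w) (by fun_prop)
    (fun w hw => by simpa [hS, dist_eq_norm] using hw)
    (fun f => lintegral_sub_left_eq_self f z)
  have hΦ₁ : Measurable fun w => Φ (z + w) := hΦ.comp (measurable_const_add z)
  have hΦ₂ : Measurable fun w => Φ (z - w) := hΦ.comp (measurable_id.const_sub z)
  obtain ⟨w, hw, hwle⟩ := exists_le_setLAverage (μ := (volume : Measure (Space p))) (s := S)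
    (f := fun w => Φ (z + w) + Φ (z - w)) hV0 hVt
    (hΦ₁.add hΦ₂).aemeasurable
  have hwK : Φ (z + w) + Φ (z - w) ≤ K₁ := by
    refine hwle.trans ?_
    rw [setLAverage_eq, lintegral_add_left hΦ₁]
    exact ENNReal.div_le_div_right (add_le_add hplus hminus) _
  have hx (x : Space p) (hxz : ‖x‖ ≤ ‖z‖ + 1) (hxK : Φ x ≤ K₁) :
      ∫ μ, Real.exp (inner ℝ x μ / vx) ∂P ≤ D / c := by
    obtain ⟨y, hy, hyle⟩ := exists_le_setLAverage (μ := (volume : Measure (Space p))) (s := S)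
      (f := fun y => H x y) hV0 hVt (hH.comp measurable_prodMk_left).aemeasurable
    have hyK : H x y ≤ ENNReal.ofReal K₂ := by
      rw [hK₂, ENNReal.ofReal_toReal (ENNReal.div_ne_top hK₁t hV0)]
      refine hyle.trans ?_
      rw [setLAverage_eq]
      exact ENNReal.div_le_div_right hxK _
    have hay : a ≤ normalDensity vy θ y := hy₀ hy
    have hK₂0 : 0 ≤ K₂ := ENNReal.toReal_nonneg
    have h1 : c ≤ tiltDensity vx vy P x y := by
      refine le_trans ?_ (le_of_klPoint_le (ha0.trans_le hay) hK₂0 hyK)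
      rw [hc]
      have := ha0.trans_le hay
      gcongr
    have hpos : 0 < ∫ μ, Real.exp (inner ℝ x μ / vx) ∂P := integral_exp_pos (hPm x)
    rw [tiltDensity, le_div_iff₀ hpos] at h1
    rw [le_div_iff₀ hc0, mul_comm]
    refine h1.trans ?_
    have h2 : ∫ μ, Real.exp (inner ℝ x μ / vx) * normalDensity vy μ y ∂P ≤ ∫ _, D ∂P := by
      refine integral_mono (integrable_exp_mul_normalDensity hvx hvy P x y)
        (integrable_const _) fun μ => ?_
      refine (exp_mul_normalDensity_le hvx hvy x y μ).trans ?_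
      have hy1 : ‖y‖ ≤ 1 := by simpa [hS] using hy
      have : 0 < 2 * Real.pi * vy := by positivity
      rw [hD]
      gcongr
    simpa using h2
  have hw1 : ‖w‖ ≤ 1 := by simpa [hS] using hw
  have h₁ := hx (z + w) ((norm_add_le _ _).trans (by linarith)) (le_self_add.trans hwK)
  have h₂ := hx (z - w) ((norm_sub_le _ _).trans (by linarith)) (le_add_self.trans hwK)
  have h₃ : ∫ μ, Real.exp (inner ℝ z μ / vx) ∂P ≤
      ∫ μ, (Real.exp (inner ℝ (z + w) μ / vx) + Real.exp (inner ℝ (z - w) μ / vx)) / 2 ∂P := by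
    refine integral_mono (hPm z) (((hPm _).add (hPm _)).div_const 2) fun μ => ?_
    simp only
    rw [inner_add_left, inner_sub_left, add_div (inner ℝ z μ), sub_div, Real.exp_add, Real.exp_sub]
    have he := Real.exp_pos (inner ℝ z μ / vx)
    have hf := Real.exp_pos (inner ℝ w μ / vx)
    set e := Real.exp (inner ℝ z μ / vx)
    set f := Real.exp (inner ℝ w μ / vx)
    have : (e * f + e / f) / 2 - e = e * (f - 1) ^ 2 / (2 * f) := by
      field_simp
      ring
    have h5 : 0 ≤ e * (f - 1) ^ 2 / (2 * f) := by positivity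
    linarith
  rw [integral_div, integral_add (hPm _) (hPm _)] at h₃
  linarith

/-! ### Compactness of posteriors with bounded Laplace transforms -/

/-- A family of probability measures with pointwise bounded Laplace transforms is tight. -/
lemma isTightMeasureSet_of_integral_exp_le (hvx : 0 < vx) {𝒮 : Set (ProbabilityMeasure (Space p))}
    (hP : ∀ P ∈ 𝒮, HasExpMoments vx (P : Measure (Space p)))
    (hK : ∀ x : Space p, ∃ K : ℝ, ∀ P ∈ 𝒮,
      ∫ μ, Real.exp (inner ℝ x μ / vx) ∂(P : Measure (Space p)) ≤ K) :
    IsTightMeasureSet {((P : ProbabilityMeasure (Space p)) : Measure (Space p)) | P ∈ 𝒮} := by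
  refine isTightMeasureSet_of_inner_tendsto ℝ fun y => ?_
  obtain ⟨K₁, hK₁⟩ := hK (vx • y)
  obtain ⟨K₂, hK₂⟩ := hK (-(vx • y))
  have hlim : Tendsto (fun r : ℝ => ENNReal.ofReal ((K₁ + K₂) / Real.exp r)) atTop (𝓝 0) := by
    rw [← ENNReal.ofReal_zero]
    exact ENNReal.tendsto_ofReal (Tendsto.div_atTop tendsto_const_nhds Real.tendsto_exp_atTop)
  refine tendsto_of_tendsto_of_tendsto_of_le_of_le tendsto_const_nhds hlim
    (fun _ => zero_le) fun r => iSup₂_le ?_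
  rintro _ ⟨P, hPm, rfl⟩
  have hexp (μ : Space p) : inner ℝ (vx • y) μ / vx = inner ℝ y μ ∧
      inner ℝ (-(vx • y)) μ / vx = -inner ℝ y μ := by
    rw [inner_neg_left, real_inner_smul_left]
    constructor <;> field_simp
  have h₁ := hP P hPm (vx • y)
  have h₂ := hP P hPm (-(vx • y))
  have h₃ := hK₁ P hPm
  have h₄ := hK₂ P hPm
  simp only [hexp] at h₁ h₂ h₃ h₄
  have hM := mul_meas_ge_le_integral_of_nonneg (μ := (P : Measure (Space p)))
    (f := fun μ => Real.exp (inner ℝ y μ) + Real.exp (-inner ℝ y μ))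
    (ae_of_all _ fun μ => by positivity) (h₁.add h₂) (Real.exp r)
  rw [integral_add h₁ h₂] at hM
  have hsub : {μ : Space p | r < ‖(inner ℝ y μ : ℝ)‖} ⊆
      {μ | Real.exp r ≤ Real.exp (inner ℝ y μ) + Real.exp (-inner ℝ y μ)} := by
    intro μ hμ
    rw [Set.mem_ofPred_eq, Real.norm_eq_abs, lt_abs] at hμ
    rw [Set.mem_ofPred_eq]
    rcases hμ with h | h
    · have := Real.exp_le_exp.2 h.le
      have := Real.exp_pos (-inner ℝ y μ)
      linarith
    · have := Real.exp_le_exp.2 h.le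
      have := Real.exp_pos (inner ℝ y μ)
      linarith
  refine (measure_mono hsub).trans ?_
  rw [← ofReal_measureReal]
  refine ENNReal.ofReal_le_ofReal ?_
  rw [le_div_iff₀ (Real.exp_pos r), mul_comm]
  linarith

/-- Weak convergence and pointwise bounds on the Laplace transforms give convergence of the
Laplace transforms: the bound at `2 • x` makes the exponential at `x` uniformly integrable. -/
lemma tendsto_integral_exp {P : ℕ → ProbabilityMeasure (Space p)}
    {Q : ProbabilityMeasure (Space p)} (hPQ : Tendsto P atTop (𝓝 Q))
    (hP : ∀ n, HasExpMoments vx (P n : Measure (Space p)))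
    (hK : ∀ x : Space p, ∃ K : ℝ, ∀ n,
      ∫ μ, Real.exp (inner ℝ x μ / vx) ∂(P n : Measure (Space p)) ≤ K) :
    HasExpMoments vx (Q : Measure (Space p)) ∧ ∀ x : Space p,
      Tendsto (fun n => ∫ μ, Real.exp (inner ℝ x μ / vx) ∂(P n : Measure (Space p))) atTop
        (𝓝 (∫ μ, Real.exp (inner ℝ x μ / vx) ∂(Q : Measure (Space p)))) := by
  have hcont (x : Space p) : Continuous fun μ : Space p => Real.exp (inner ℝ x μ / vx) := by
    fun_prop
  have hnn (x : Space p) (R : Measure (Space p)) :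
      0 ≤ᵐ[R] fun μ : Space p => Real.exp (inner ℝ x μ / vx) :=
    ae_of_all _ fun μ => (Real.exp_pos _).le
  have hbound (x : Space p) (K : ℝ)
      (hKx : ∀ n, ∫ μ, Real.exp (inner ℝ x μ / vx) ∂(P n : Measure (Space p)) ≤ K) :
      ∫⁻ μ, ENNReal.ofReal (Real.exp (inner ℝ x μ / vx)) ∂(Q : Measure (Space p))
        ≤ ENNReal.ofReal K := by
    refine (lintegral_le_liminf_lintegral_of_forall_isOpen_measure_le_liminf_measure (hcont x)
      (fun μ => (Real.exp_pos _).le) fun G hG =>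
        ProbabilityMeasure.le_liminf_measure_open_of_tendsto hPQ hG).trans ?_
    refine (liminf_le_liminf (v := fun _ => ENNReal.ofReal K) (Eventually.of_forall fun n => ?_)
      ).trans (by simp)
    rw [← ofReal_integral_eq_lintegral_ofReal (hP n x) (hnn x _)]
    exact ENNReal.ofReal_le_ofReal (hKx n)
  have hQ : HasExpMoments vx (Q : Measure (Space p)) := by
    intro x
    obtain ⟨K, hKx⟩ := hK x
    refine ⟨(hcont x).aestronglyMeasurable, ?_⟩
    rw [hasFiniteIntegral_iff_ofReal (hnn x _)]
    exact (hbound x K hKx).trans_lt ENNReal.ofReal_lt_top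
  refine ⟨hQ, fun x => ?_⟩
  obtain ⟨K, hKx⟩ := hK ((2 : ℝ) • x)
  have hK0 : 0 ≤ K := (integral_nonneg fun μ => (Real.exp_pos _).le).trans (hKx 0)
  have hQK : ∫ μ, Real.exp (inner ℝ ((2 : ℝ) • x) μ / vx) ∂(Q : Measure (Space p)) ≤ K := by
    have h := hbound _ K hKx
    rwa [← ofReal_integral_eq_lintegral_ofReal (hQ _) (hnn _ _),
      ENNReal.ofReal_le_ofReal_iff hK0] at h
  -- Truncating the exponential at `T` changes its integral by at most `K / T`.
  have htrunc (T : ℝ) (hT : 0 < T) (ν : Measure (Space p)) [IsProbabilityMeasure ν]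
      (hν : HasExpMoments vx ν)
      (hνK : ∫ μ, Real.exp (inner ℝ ((2 : ℝ) • x) μ / vx) ∂ν ≤ K) :
      |∫ μ, Real.exp (inner ℝ x μ / vx) ∂ν - ∫ μ, min (Real.exp (inner ℝ x μ / vx)) T ∂ν|
        ≤ K / T := by
    have hmin : Integrable (fun μ => min (Real.exp (inner ℝ x μ / vx)) T) ν :=
      (hν x).inf (integrable_const T)
    rw [← integral_sub (hν x) hmin, abs_of_nonneg
      (integral_nonneg fun μ => sub_nonneg.2 (min_le_left _ _))]
    refine (integral_mono ((hν x).sub hmin) ((hν ((2 : ℝ) • x)).div_const T) fun μ => ?_).trans ?_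
    · simp only [Pi.sub_apply]
      rw [real_inner_smul_left, mul_div_assoc, two_mul, Real.exp_add, le_div_iff₀ hT]
      set e := Real.exp (inner ℝ x μ / vx)
      have he : 0 < e := Real.exp_pos _
      rcases le_total e T with h | h
      · rw [min_eq_left h]
        nlinarith
      · rw [min_eq_right h]
        nlinarith
    · rw [integral_div]
      gcongr
  have hmin (T : ℝ) (hT : 0 < T) :
      Tendsto (fun n => ∫ μ, min (Real.exp (inner ℝ x μ / vx)) T ∂(P n : Measure (Space p))) atTop
        (𝓝 (∫ μ, min (Real.exp (inner ℝ x μ / vx)) T ∂(Q : Measure (Space p)))) := by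
    let f : BoundedContinuousFunction (Space p) ℝ := BoundedContinuousFunction.ofNormedAddCommGroup
      (fun μ => min (Real.exp (inner ℝ x μ / vx)) T) ((hcont x).min continuous_const) T
      fun μ => by
        rw [Real.norm_of_nonneg (le_min (Real.exp_pos _).le hT.le)]
        exact min_le_right _ _
    exact ProbabilityMeasure.tendsto_iff_forall_integral_tendsto.1 hPQ f
  rw [Metric.tendsto_atTop]
  intro ε hε
  set T : ℝ := 3 * (K + 1) / ε with hTdef
  have hT : 0 < T := by positivity
  have hKT : K / T < ε / 3 := by
    rw [hTdef, div_div_eq_mul_div, div_lt_div_iff₀ (by positivity) (by positivity)]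
    nlinarith
  obtain ⟨N, hN⟩ := Metric.tendsto_atTop.1 (hmin T hT) (ε / 3) (by positivity)
  refine ⟨N, fun n hn => ?_⟩
  have h₁ := htrunc T hT _ (hP n) (hKx n)
  have h₂ := htrunc T hT _ hQ hQK
  have h₃ := hN n hn
  rw [Real.dist_eq] at h₃ ⊢
  rw [abs_le] at h₁ h₂
  rw [abs_lt] at h₃ ⊢
  constructor <;> linarith

/-- Posteriors of bounded risk at one parameter have a subsequence whose predictive densities
converge pointwise to the predictive density of a posterior. -/
theorem exists_subseq_tendsto_tiltDensity (hvx : 0 < vx) (hvy : 0 < vy)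
    {P : ℕ → ProbabilityMeasure (Space p)}
    (hP : ∀ n, HasExpMoments vx (P n : Measure (Space p))) (θ : Space p) {C : ℝ≥0∞} (hC : C ≠ ∞)
    (hrisk : ∀ n, predRisk vx vy θ (tiltDensity vx vy (P n : Measure (Space p))) ≤ C) :
    ∃ (Q : ProbabilityMeasure (Space p)) (φ : ℕ → ℕ), StrictMono φ ∧
      HasExpMoments vx (Q : Measure (Space p)) ∧ ∀ x y,
        Tendsto (fun n => tiltDensity vx vy (P (φ n) : Measure (Space p)) x y) atTop
          (𝓝 (tiltDensity vx vy (Q : Measure (Space p)) x y)) := by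
  have hK (x : Space p) : ∃ K : ℝ, ∀ n,
      ∫ μ, Real.exp (inner ℝ x μ / vx) ∂(P n : Measure (Space p)) ≤ K := by
    obtain ⟨K, hK⟩ := exists_integral_exp_le hvx hvy θ x hC
    exact ⟨K, fun n => hK _ inferInstance (hP n) (hrisk n)⟩
  have htight : IsTightMeasureSet
      {((R : ProbabilityMeasure (Space p)) : Measure (Space p)) | R ∈ Set.range P} := by
    refine isTightMeasureSet_of_integral_exp_le hvx ?_ fun x => ?_
    · rintro _ ⟨n, rfl⟩
      exact hP n
    · obtain ⟨K, hKx⟩ := hK x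
      refine ⟨K, ?_⟩
      rintro _ ⟨n, rfl⟩
      exact hKx n
  obtain ⟨Q, -, φ, hφ, hlim⟩ := (isCompact_closure_of_isTightMeasureSet htight).tendsto_subseq
    (fun n => subset_closure (Set.mem_range_self n))
  obtain ⟨hQ, hQlim⟩ := tendsto_integral_exp hlim (fun n => hP (φ n)) fun x => by
    obtain ⟨K, hKx⟩ := hK x
    exact ⟨K, fun n => hKx (φ n)⟩
  refine ⟨Q, φ, hφ, hQ, fun x y => ?_⟩
  refine Tendsto.div ?_ (hQlim x) (integral_exp_pos (hQ x)).ne'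
  let f : BoundedContinuousFunction (Space p) ℝ := BoundedContinuousFunction.ofNormedAddCommGroup
    (fun μ => Real.exp (inner ℝ x μ / vx) * normalDensity vy μ y)
    (continuous_exp_mul_normalDensity x y) _ fun μ => by
      rw [Real.norm_of_nonneg (mul_nonneg (Real.exp_pos _).le (normalDensity_pos hvy μ y).le)]
      exact exp_mul_normalDensity_le hvx hvy x y μ
  exact ProbabilityMeasure.tendsto_iff_forall_integral_tendsto.1 hlim f

/-! ### Bayes procedures for finitely supported priors -/

/-- The Bayes predictive density for the prior with weights `π j` at the points `s j`. -/
def mixDensity {ι : Type*} [Fintype ι] (vx vy : ℝ) (s : ι → Space p) (π : ι → ℝ)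
    (x y : Space p) : ℝ :=
  (∑ j, π j * normalDensity vx (s j) x * normalDensity vy (s j) y) /
    ∑ j, π j * normalDensity vx (s j) x

lemma sum_mul_pos_of_mem_stdSimplex {ι : Type*} [Fintype ι] {π : ι → ℝ}
    (hπ : π ∈ stdSimplex ℝ ι) {a : ι → ℝ} (ha : ∀ j, 0 < a j) : 0 < ∑ j, π j * a j := by
  obtain ⟨i, -, hi⟩ : ∃ i ∈ Finset.univ, 0 < π i := by
    by_contra! h
    have := Finset.sum_nonpos h
    rw [hπ.2] at this
    exact absurd this (by norm_num)
  exact Finset.sum_pos' (fun j _ => mul_nonneg (hπ.1 j) (ha j).le)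
    ⟨i, Finset.mem_univ i, mul_pos hi (ha i)⟩

lemma mixDensity_pos {ι : Type*} [Fintype ι] (hvx : 0 < vx) (hvy : 0 < vy) (s : ι → Space p)
    {π : ι → ℝ} (hπ : π ∈ stdSimplex ℝ ι) (x y : Space p) : 0 < mixDensity vx vy s π x y := by
  refine div_pos ?_ (sum_mul_pos_of_mem_stdSimplex hπ fun j => normalDensity_pos hvx _ _)
  simp_rw [mul_assoc]
  exact sum_mul_pos_of_mem_stdSimplex hπ fun j =>
    mul_pos (normalDensity_pos hvx _ _) (normalDensity_pos hvy _ _)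

lemma measurable_mixDensity {ι Ω : Type*} [Fintype ι] [MeasurableSpace Ω] (s : ι → Space p)
    (π : ι → ℝ) {X Y : Ω → Space p} (hX : Measurable X) (hY : Measurable Y) :
    Measurable fun ω => mixDensity vx vy s π (X ω) (Y ω) := by
  unfold mixDensity
  fun_prop

/-- The Bayes property: on any space carrying an observation `X` and a point `Y` at which densities
are evaluated, the mixture density minimises the weighted sum of the integrated losses. -/
lemma sum_lintegral_mixDensity_le {ι Ω : Type*} [Fintype ι] [MeasurableSpace Ω] (τ : Measure Ω)
    (hvx : 0 < vx) (hvy : 0 < vy) (s : ι → Space p) {π : ι → ℝ} (hπ : π ∈ stdSimplex ℝ ι)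
    {X Y : Ω → Space p} {a : Ω → ℝ} (hX : Measurable X) (hY : Measurable Y) (ha : Measurable a) :
    ∑ j, ENNReal.ofReal (π j) * ∫⁻ ω, klPoint (normalDensity vy (s j) (Y ω))
        (mixDensity vx vy s π (X ω) (Y ω)) * ENNReal.ofReal (normalDensity vx (s j) (X ω)) ∂τ
      ≤ ∑ j, ENNReal.ofReal (π j) * ∫⁻ ω, klPoint (normalDensity vy (s j) (Y ω)) (a ω)
          * ENNReal.ofReal (normalDensity vx (s j) (X ω)) ∂τ := by
  have hmix : Measurable fun ω => mixDensity vx vy s π (X ω) (Y ω) :=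
    measurable_mixDensity s π hX hY
  have hmeas (b : Ω → ℝ) (hb : Measurable b) (j : ι) :
      Measurable fun ω => klPoint (normalDensity vy (s j) (Y ω)) (b ω)
        * ENNReal.ofReal (normalDensity vx (s j) (X ω)) := by
    fun_prop
  have hsum (b : Ω → ℝ) (hb : Measurable b) :
      ∑ j, ENNReal.ofReal (π j) * ∫⁻ ω, klPoint (normalDensity vy (s j) (Y ω)) (b ω)
          * ENNReal.ofReal (normalDensity vx (s j) (X ω)) ∂τ
        = ∫⁻ ω, ∑ j, ENNReal.ofReal (π j * normalDensity vx (s j) (X ω))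
          * klPoint (normalDensity vy (s j) (Y ω)) (b ω) ∂τ := by
    rw [lintegral_finsetSum _ fun j _ => by fun_prop]
    refine Finset.sum_congr rfl fun j _ => ?_
    rw [← lintegral_const_mul _ (hmeas b hb j)]
    refine lintegral_congr fun ω => ?_
    rw [ENNReal.ofReal_mul (hπ.1 j)]
    ring
  rw [hsum _ hmix, hsum a ha]
  refine lintegral_mono fun ω => ?_
  exact sum_klPoint_mean_le (fun j => π j * normalDensity vx (s j) (X ω)) _
    (fun j => mul_nonneg (hπ.1 j) (normalDensity_pos hvx _ _).le)
    (fun j => normalDensity_pos hvy _ _)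
    (sum_mul_pos_of_mem_stdSimplex hπ fun j => normalDensity_pos hvx _ _) (a ω)

/-- As a function of the mean, the normal density is an exponential tilt of its value at `0`. -/
lemma normalDensity_eq_mul_exp (hvx : 0 < vx) (μ x : Space p) :
    normalDensity vx μ x = normalDensity vx μ 0 * Real.exp (inner ℝ x μ / vx)
      * Real.exp (-(‖x‖ ^ 2 / (2 * vx))) := by
  have h : -(‖x - μ‖ ^ 2 / (2 * vx)) =
      -(‖0 - μ‖ ^ 2 / (2 * vx)) + inner ℝ x μ / vx + -(‖x‖ ^ 2 / (2 * vx)) := by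
    rw [norm_sub_sq_real, zero_sub, norm_neg]
    field_simp
    ring
  unfold normalDensity
  rw [h, Real.exp_add, Real.exp_add]
  ring

/-- The Bayes density of a finitely supported prior is the predictive density of its posterior at
the observation `0`. -/
lemma exists_tiltDensity_eq_mixDensity {ι : Type*} [Fintype ι] (hvx : 0 < vx) (s : ι → Space p)
    {π : ι → ℝ} (hπ : π ∈ stdSimplex ℝ ι) :
    ∃ P : ProbabilityMeasure (Space p), HasExpMoments vx (P : Measure (Space p)) ∧
      ∀ x y, tiltDensity vx vy (P : Measure (Space p)) x y = mixDensity vx vy s π x y := by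
  have hW : 0 < ∑ j, π j * normalDensity vx (s j) 0 :=
    sum_mul_pos_of_mem_stdSimplex hπ fun j => normalDensity_pos hvx _ _
  set W := ∑ j, π j * normalDensity vx (s j) 0 with hWdef
  let w : ι → ℝ := fun j => π j * normalDensity vx (s j) 0 / W
  have hw (j : ι) : 0 ≤ w j :=
    div_nonneg (mul_nonneg (hπ.1 j) (normalDensity_pos hvx _ _).le) hW.le
  have hw1 : ∑ j, w j = 1 := by
    simp only [w]
    rw [← Finset.sum_div, div_self hW.ne']
  let P : Measure (Space p) := ∑ j, ENNReal.ofReal (w j) • Measure.dirac (s j)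
  have hP : IsProbabilityMeasure P := by
    refine ⟨?_⟩
    simp only [P, Measure.coe_finsetSum, Finset.sum_apply, Measure.smul_apply, measure_univ,
      smul_eq_mul, mul_one]
    rw [← ENNReal.ofReal_sum_of_nonneg fun j _ => hw j, hw1, ENNReal.ofReal_one]
  have hint (f : Space p → ℝ) (j : ι) :
      Integrable f (ENNReal.ofReal (w j) • Measure.dirac (s j)) :=
    (integrable_dirac (by finiteness)).smul_measure ENNReal.ofReal_ne_top
  have hintegral (f : Space p → ℝ) : ∫ μ, f μ ∂P = ∑ j, w j * f (s j) := by
    simp only [P]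
    rw [integral_finsetSum_measure fun j _ => hint f j]
    refine Finset.sum_congr rfl fun j _ => ?_
    rw [integral_smul_measure, integral_dirac, ENNReal.toReal_ofReal (hw j), smul_eq_mul]
  refine ⟨⟨P, hP⟩, fun x => integrable_finsetSum_measure.2 fun j _ => hint _ j, fun x y => ?_⟩
  have hx := Real.exp_pos (-(‖x‖ ^ 2 / (2 * vx)))
  set E := Real.exp (-(‖x‖ ^ 2 / (2 * vx))) with hE
  have hnum : ∑ j, π j * normalDensity vx (s j) x * normalDensity vy (s j) y
      = (W * E) * ∑ j, w j * (Real.exp (inner ℝ x (s j) / vx) * normalDensity vy (s j) y) := by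
    rw [Finset.mul_sum]
    refine Finset.sum_congr rfl fun j _ => ?_
    rw [normalDensity_eq_mul_exp hvx (s j) x, ← hE]
    simp only [w]
    field_simp
  have hden : ∑ j, π j * normalDensity vx (s j) x
      = (W * E) * ∑ j, w j * Real.exp (inner ℝ x (s j) / vx) := by
    rw [Finset.mul_sum]
    refine Finset.sum_congr rfl fun j _ => ?_
    rw [normalDensity_eq_mul_exp hvx (s j) x, ← hE]
    simp only [w]
    field_simp
  rw [tiltDensity, mixDensity, hnum, hden, mul_div_mul_left _ _ (mul_pos hW hx).ne']
  simp only [ProbabilityMeasure.coe_mk]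
  rw [hintegral, hintegral]

/-! ### Domination by a limit of Bayes procedures -/

/-- Fatou's lemma for the risk, jointly in the parameter and the predictive density. -/
lemma predRisk_le_liminf (hvy : 0 < vy) {θ : ℕ → Space p} {θ₀ : Space p}
    {q : ℕ → Space p → Space p → ℝ} {q₀ : Space p → Space p → ℝ}
    (hq : ∀ n, Measurable fun z : Space p × Space p => q n z.1 z.2)
    (hθ : Tendsto θ atTop (𝓝 θ₀)) (hlim : ∀ x y, Tendsto (fun n => q n x y) atTop (𝓝 (q₀ x y)))
    (hpos : ∀ x y, 0 < q₀ x y) :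
    predRisk vx vy θ₀ q₀ ≤ liminf (fun n => predRisk vx vy (θ n) (q n)) atTop := by
  unfold predRisk
  refine le_trans (lintegral_mono fun z => ?_) (lintegral_liminf_le fun n => ?_)
  · have hN (v : ℝ) (y : Space p) : Tendsto (fun n => normalDensity v (θ n) y) atTop
        (𝓝 (normalDensity v θ₀ y)) := by
      have : Continuous fun μ : Space p => normalDensity v μ y := by fun_prop
      exact (this.tendsto θ₀).comp hθ
    refine (Tendsto.liminf_eq (ENNReal.Tendsto.mul ?_ (Or.inr ENNReal.ofReal_ne_top)
      (ENNReal.tendsto_ofReal (hN vx z.1)) (Or.inr ?_))).ge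
    · exact tendsto_klPoint (hN vy z.2) (hlim z.1 z.2) (normalDensity_pos hvy _ _) (hpos _ _)
    · rw [klPoint_of_pos (hpos _ _)]
      exact ENNReal.ofReal_ne_top
  · have := hq n
    fun_prop

/-- Let `c` be finite somewhere and have, under every finitely supported prior, an average at least
the Bayes risk. Then some posterior has a predictive density whose risk is below `c` everywhere. -/
theorem exists_tiltDensity_predRisk_le (hvx : 0 < vx) (hvy : 0 < vy) (c : Space p → ℝ≥0∞)
    (hfin : ∃ θ, c θ ≠ ∞)
    (hc : ∀ (n : ℕ) (s : Fin (n + 1) → Space p), ∀ π ∈ stdSimplex ℝ (Fin (n + 1)),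
      ∑ j, ENNReal.ofReal (π j) * predRisk vx vy (s j) (mixDensity vx vy s π)
        ≤ ∑ j, ENNReal.ofReal (π j) * c (s j)) :
    ∃ Q : ProbabilityMeasure (Space p), HasExpMoments vx (Q : Measure (Space p)) ∧
      ∀ θ, predRisk vx vy θ (tiltDensity vx vy (Q : Measure (Space p))) ≤ c θ := by
  -- A dense sequence in the graph of `c`; density of its parameters alone would not suffice, since
  -- `c` need not be continuous.
  let G : Set (Space p × ℝ) := {z | c z.1 ≠ ∞ ∧ z.2 = (c z.1).toReal}
  obtain ⟨θ₀, hθ₀⟩ := hfin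
  have : Nonempty G := ⟨⟨(θ₀, (c θ₀).toReal), hθ₀, rfl⟩⟩
  let d : ℕ → G := TopologicalSpace.denseSeq G
  have hd : DenseRange d := TopologicalSpace.denseRange_denseSeq G
  let θ : ℕ → Space p := fun n => (d n).1.1
  have hθ (n : ℕ) : c (θ n) ≠ ∞ := (d n).2.1
  -- On its first `n + 1` points the finite game has a solution.
  have hgame (n : ℕ) : ∃ P : ProbabilityMeasure (Space p),
      HasExpMoments vx (P : Measure (Space p)) ∧ ∀ i ≤ n,
        predRisk vx vy (θ i) (tiltDensity vx vy (P : Measure (Space p))) ≤ c (θ i) := by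
    let s : Fin (n + 1) → Space p := fun i => θ i
    obtain ⟨π, hπ, hle⟩ := exists_mem_stdSimplex_forall_le
      (fun π i => predRisk vx vy (s i) (mixDensity vx vy s π)) (fun i => c (s i))
      (fun i => hθ i)
      (fun π hπ π' _ => sum_lintegral_mixDensity_le _ hvx hvy s hπ measurable_fst measurable_snd
        (measurable_mixDensity s π' measurable_fst measurable_snd))
      (fun π hπ => hc n s π hπ)
      (fun i π hπ u hu hlim => by
        refine predRisk_le_liminf hvy
          (fun n => measurable_mixDensity s (u n) measurable_fst measurable_snd)
          tendsto_const_nhds (fun x y => ?_) (mixDensity_pos hvx hvy s hπ)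
        rw [tendsto_pi_nhds] at hlim
        refine Tendsto.div ?_ ?_
          (sum_mul_pos_of_mem_stdSimplex hπ fun j => normalDensity_pos hvx _ _).ne'
        · exact tendsto_finsetSum _ fun j _ => ((hlim j).mul_const _).mul_const _
        · exact tendsto_finsetSum _ fun j _ => (hlim j).mul_const _)
    obtain ⟨P, hP, hPeq⟩ := exists_tiltDensity_eq_mixDensity (vy := vy) hvx s hπ
    refine ⟨P, hP, fun i hi => ?_⟩
    have h : tiltDensity vx vy (P : Measure (Space p)) = mixDensity vx vy s π := by
      funext x y
      exact hPeq x y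
    rw [h]
    exact hle ⟨i, Nat.lt_succ_of_le hi⟩
  choose P hP hPle using hgame
  obtain ⟨Q, φ, hφ, hQ, hlim⟩ := exists_subseq_tendsto_tiltDensity hvx hvy hP (θ 0) (hθ 0)
    fun n => hPle n 0 n.zero_le
  refine ⟨Q, hQ, fun ϑ => ?_⟩
  have hpos := tiltDensity_pos hvx hvy hQ
  have hseq (i : ℕ) :
      predRisk vx vy (θ i) (tiltDensity vx vy (Q : Measure (Space p))) ≤ c (θ i) := by
    refine (predRisk_le_liminf hvy (fun n => measurable_tiltDensity (P (φ n) : Measure (Space p)))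
      (tendsto_const_nhds (x := θ i)) hlim hpos).trans ?_
    refine liminf_le_of_frequently_le' (Eventually.frequently ?_)
    filter_upwards [hφ.tendsto_atTop.eventually_ge_atTop i] with n hn using hPle _ i hn
  rcases eq_or_ne (c ϑ) ∞ with h | h
  · exact h ▸ le_top
  obtain ⟨u, hu, hulim⟩ := mem_closure_iff_seq_limit.1 (hd ⟨(ϑ, (c ϑ).toReal), h, rfl⟩)
  have hu' (n : ℕ) : predRisk vx vy (u n).1.1 (tiltDensity vx vy (Q : Measure (Space p)))
      ≤ ENNReal.ofReal (u n).1.2 := by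
    obtain ⟨k, hk⟩ := hu n
    rw [← hk, (d k).2.2, ENNReal.ofReal_toReal (d k).2.1]
    exact hseq k
  have hz : Tendsto (fun n => (u n).1) atTop (𝓝 (ϑ, (c ϑ).toReal)) :=
    (continuous_subtype_val.tendsto _).comp hulim
  refine (predRisk_le_liminf hvy (fun _ => measurable_tiltDensity (Q : Measure (Space p)))
    ((continuous_fst.tendsto _).comp hz) (fun x y => tendsto_const_nhds) hpos).trans ?_
  refine (liminf_le_liminf (Eventually.of_forall hu')).trans (le_of_eq ?_)
  rw [← ENNReal.ofReal_toReal h]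
  exact (ENNReal.tendsto_ofReal ((continuous_snd.tendsto _).comp hz)).liminf_eq

/-! ### From posteriors to generalized Bayes procedures -/

/-- The prior whose posterior at the observation `0` is `Q`. -/
def untilt (vx : ℝ) (Q : Measure (Space p)) : Measure (Space p) :=
  Q.withDensity fun μ => ENNReal.ofReal (Real.exp (‖μ‖ ^ 2 / (2 * vx)))

lemma exp_mul_normalDensity (hvx : 0 < vx) (μ x : Space p) :
    Real.exp (‖μ‖ ^ 2 / (2 * vx)) * normalDensity vx μ x =
      ((2 * Real.pi * vx) ^ (-(p : ℝ) / 2) * Real.exp (-(‖x‖ ^ 2 / (2 * vx)))) *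
        Real.exp (inner ℝ x μ / vx) := by
  have h : -(‖x - μ‖ ^ 2 / (2 * vx)) =
      -(‖μ‖ ^ 2 / (2 * vx)) + inner ℝ x μ / vx + -(‖x‖ ^ 2 / (2 * vx)) := by
    rw [norm_sub_sq_real]
    field_simp
    ring
  unfold normalDensity
  rw [h, Real.exp_add, Real.exp_add, Real.exp_neg (‖μ‖ ^ 2 / (2 * vx))]
  have := Real.exp_pos (‖μ‖ ^ 2 / (2 * vx))
  field_simp

lemma isPrior_untilt (hvx : 0 < vx) {Q : Measure (Space p)} [IsProbabilityMeasure Q]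
    (hQ : HasExpMoments vx Q) : IsPrior vx (untilt vx Q) where
  locallyFinite := IsLocallyFiniteMeasure.withDensity_ofReal (by fun_prop)
  ne_zero := by
    intro h
    have h1 : (1 : ℝ≥0∞) ≤ untilt vx Q Set.univ := by
      rw [untilt, withDensity_apply _ MeasurableSet.univ, Measure.restrict_univ]
      calc (1 : ℝ≥0∞) = ∫⁻ _, 1 ∂Q := by simp
        _ ≤ _ := lintegral_mono fun μ => by
          rw [← ENNReal.ofReal_one]
          exact ENNReal.ofReal_le_ofReal (Real.one_le_exp (by positivity))
    rw [h] at h1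
    simp at h1
  marginal_lt_top x := by
    rw [untilt, lintegral_withDensity_eq_lintegral_mul _ (by fun_prop)
      (Measurable.ennreal_ofReal (by fun_prop))]
    have h := ((hQ x).const_mul ((2 * Real.pi * vx) ^ (-(p : ℝ) / 2) *
      Real.exp (-(‖x‖ ^ 2 / (2 * vx))))).lintegral_lt_top
    refine (lintegral_congr fun μ => ?_).trans_lt h
    rw [Pi.mul_apply, ← ENNReal.ofReal_mul (Real.exp_pos _).le, exp_mul_normalDensity hvx]

lemma bayesDensity_untilt (hvx : 0 < vx) (Q : Measure (Space p)) (x y : Space p) :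
    bayesDensity vx vy (untilt vx Q) x y = tiltDensity vx vy Q x y := by
  have h (f : Space p → ℝ) : ∫ μ, f μ ∂(untilt vx Q)
      = ∫ μ, Real.exp (‖μ‖ ^ 2 / (2 * vx)) * f μ ∂Q := by
    rw [untilt, integral_withDensity_eq_integral_toReal_smul (by fun_prop) (by simp)]
    simp [Real.exp_nonneg]
  have hk : 0 < (2 * Real.pi * vx) ^ (-(p : ℝ) / 2) * Real.exp (-(‖x‖ ^ 2 / (2 * vx))) := by
    have : 0 < 2 * Real.pi * vx := by positivity
    positivity
  rw [bayesDensity, tiltDensity, h, h]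
  simp_rw [← mul_assoc, exp_mul_normalDensity hvx, mul_assoc _ (Real.exp (inner ℝ x _ / vx)) _]
  rw [integral_const_mul, integral_const_mul, mul_div_mul_left _ _ hk.ne']

lemma lintegral_tiltDensity (hvx : 0 < vx) (hvy : 0 < vy) {Q : Measure (Space p)}
    [IsProbabilityMeasure Q] (hQ : HasExpMoments vx Q) (x : Space p) :
    ∫⁻ y, ENNReal.ofReal (tiltDensity vx vy Q x y) = 1 := by
  have hden : 0 < ∫ μ, Real.exp (inner ℝ x μ / vx) ∂Q := integral_exp_pos (hQ x)
  have hnum (y : Space p) : ENNReal.ofReal (∫ μ, Real.exp (inner ℝ x μ / vx)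
      * normalDensity vy μ y ∂Q) = ∫⁻ μ, ENNReal.ofReal (Real.exp (inner ℝ x μ / vx))
      * ENNReal.ofReal (normalDensity vy μ y) ∂Q := by
    rw [ofReal_integral_eq_lintegral_ofReal (integrable_exp_mul_normalDensity hvx hvy Q x y)
      (ae_of_all _ fun μ => mul_nonneg (Real.exp_pos _).le (normalDensity_pos hvy μ y).le)]
    exact lintegral_congr fun μ => ENNReal.ofReal_mul (Real.exp_pos _).le
  have hmeas : Measurable fun z : Space p × Space p =>
      ENNReal.ofReal (Real.exp (inner ℝ x z.2 / vx)) * ENNReal.ofReal (normalDensity vy z.2 z.1) := by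
    fun_prop
  calc ∫⁻ y, ENNReal.ofReal (tiltDensity vx vy Q x y)
      = ∫⁻ y, (∫⁻ μ, ENNReal.ofReal (Real.exp (inner ℝ x μ / vx))
          * ENNReal.ofReal (normalDensity vy μ y) ∂Q)
          / ENNReal.ofReal (∫ μ, Real.exp (inner ℝ x μ / vx) ∂Q) := by
        refine lintegral_congr fun y => ?_
        rw [tiltDensity, ENNReal.ofReal_div_of_pos hden, hnum]
    _ = (∫⁻ y, ∫⁻ μ, ENNReal.ofReal (Real.exp (inner ℝ x μ / vx))
          * ENNReal.ofReal (normalDensity vy μ y) ∂Q)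
          / ENNReal.ofReal (∫ μ, Real.exp (inner ℝ x μ / vx) ∂Q) := by
        simp_rw [div_eq_mul_inv]
        exact lintegral_mul_const _ hmeas.lintegral_prod_right'
    _ = (∫⁻ μ, ENNReal.ofReal (Real.exp (inner ℝ x μ / vx)) ∂Q)
          / ENNReal.ofReal (∫ μ, Real.exp (inner ℝ x μ / vx) ∂Q) := by
        rw [lintegral_lintegral_swap hmeas.aemeasurable]
        congr 1
        refine lintegral_congr fun μ => ?_
        have hN : Measurable fun y => ENNReal.ofReal (normalDensity vy μ y) := by fun_prop
        rw [lintegral_const_mul _ hN, lintegral_normalDensity hvy, mul_one]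
    _ = 1 := by
        rw [← ofReal_integral_eq_lintegral_ofReal (hQ x) (ae_of_all _ fun _ => (Real.exp_pos _).le)]
        exact ENNReal.div_self (by simpa using hden) ENNReal.ofReal_ne_top

/-- The action chosen at `x` by the Bayes procedure with posterior `Q` at the observation `0`. -/
def tiltAction (hvx : 0 < vx) (hvy : 0 < vy) (Q : Measure (Space p)) [IsProbabilityMeasure Q]
    (hQ : HasExpMoments vx Q) (x : Space p) : Density p where
  toFun := tiltDensity vx vy Q x
  measurable_toFun := measurable_tiltDensity_right Q x
  nonneg y := (tiltDensity_pos hvx hvy hQ x y).le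
  lintegral_eq_one := lintegral_tiltDensity hvx hvy hQ x

lemma measurable_tiltAction (hvx : 0 < vx) (hvy : 0 < vy) (Q : Measure (Space p))
    [IsProbabilityMeasure Q] (hQ : HasExpMoments vx Q) : Measurable (tiltAction hvx hvy Q hQ) := by
  refine measurable_comap_iff.2 (Measure.measurable_of_measurable_coe _ fun s hs => ?_)
  have h : ∀ x, ((fun g : Density p => (volume : Measure (Space p)).withDensity
      fun y => ENNReal.ofReal (g y)) ∘ tiltAction hvx hvy Q hQ) x s
      = ∫⁻ y in s, ENNReal.ofReal (tiltDensity vx vy Q x y) := fun x => withDensity_apply _ hs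
  simp_rw [h]
  exact (measurable_tiltDensity Q).ennreal_ofReal.lintegral_prod_right'

/-! ### Measurability on the action space -/

/-- Evaluation of a density at a point is not measurable on the action space, but it has a jointly
measurable version, a Radon-Nikodym derivative of kernels. -/
lemma exists_measurable_version (p : ℕ) : ∃ G : Density p → Space p → ℝ,
    Measurable (Function.uncurry G) ∧ (∀ g y, 0 ≤ G g y) ∧ ∀ g : Density p, ∀ᵐ y, G g y = g y := by
  let κ : Kernel (Density p) (Space p) :=
    ⟨fun g => (volume : Measure (Space p)).withDensity fun y => ENNReal.ofReal (g y),
      comap_measurable _⟩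
  have hκ : IsMarkovKernel κ := ⟨fun g => ⟨by
    change (volume : Measure (Space p)).withDensity (fun y => ENNReal.ofReal (g y)) Set.univ = 1
    rw [withDensity_apply _ MeasurableSet.univ, Measure.restrict_univ, g.lintegral_eq_one]⟩⟩
  let ν : Measure (Space p) := volume.withDensity fun y => ENNReal.ofReal (normalDensity 1 0 y)
  have hN : Measurable fun y : Space p => ENNReal.ofReal (normalDensity 1 0 y) := by fun_prop
  have hν : IsProbabilityMeasure ν := ⟨by
    rw [withDensity_apply _ MeasurableSet.univ, Measure.restrict_univ,
      lintegral_normalDensity one_pos]⟩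
  have hpos (y : Space p) : 0 < normalDensity 1 0 y := normalDensity_pos one_pos 0 y
  refine ⟨fun g y => (Kernel.rnDeriv κ (Kernel.const _ ν) g y).toReal * normalDensity 1 0 y,
    ?_, fun g y => mul_nonneg ENNReal.toReal_nonneg (hpos y).le, fun g => ?_⟩
  · refine Measurable.mul (Kernel.measurable_rnDeriv κ _).ennreal_toReal ?_
    fun_prop
  · have hg := g.measurable_toFun
    have hr : Measurable fun y => ENNReal.ofReal (g y / normalDensity 1 0 y) := by
      have : Measurable fun y : Space p => normalDensity 1 0 y := by fun_prop
      exact (hg.div this).ennreal_ofReal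
    have hκg : κ g = ν.withDensity fun y => ENNReal.ofReal (g y / normalDensity 1 0 y) := by
      change (volume : Measure (Space p)).withDensity (fun y => ENNReal.ofReal (g y)) = _
      rw [← withDensity_mul _ hN hr]
      congr 1
      funext y
      rw [Pi.mul_apply, ← ENNReal.ofReal_mul (hpos y).le, mul_div_cancel₀ _ (hpos y).ne']
    have h1 : Kernel.rnDeriv κ (Kernel.const _ ν) g =ᵐ[ν] (κ g).rnDeriv ν :=
      Kernel.rnDeriv_eq_rnDeriv_measure (η := Kernel.const _ ν)
    have h2 := Measure.rnDeriv_withDensity ν hr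
    rw [← hκg] at h2
    have h3 := (ae_withDensity_iff hN).1 (h1.trans h2)
    filter_upwards [h3] with y hy
    rw [hy (by simpa using hpos y), ENNReal.toReal_ofReal (div_nonneg (g.nonneg y) (hpos y).le)]
    exact div_mul_cancel₀ _ (hpos y).ne'

lemma measurableSet_ae_eq {h : Space p → ℝ} (hh : Measurable h) :
    MeasurableSet {g : Density p | ∀ᵐ y, g y = h y} := by
  obtain ⟨G, hG, -, hGe⟩ := exists_measurable_version p
  have hs : MeasurableSet {z : Density p × Space p | ¬ Function.uncurry G z = h z.2} :=
    (measurableSet_eq_fun hG (hh.comp measurable_snd)).compl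
  have h1 : {g : Density p | ∀ᵐ y, g y = h y} = {g : Density p | (volume : Measure (Space p))
      (Prod.mk g ⁻¹' {z : Density p × Space p | ¬ Function.uncurry G z = h z.2}) = 0} := by
    ext g
    have h2 : (∀ᵐ y, g y = h y) ↔ ∀ᵐ y, G g y = h y :=
      ⟨fun H => by filter_upwards [H, hGe g] with y h1 h2 using h2.trans h1,
        fun H => by filter_upwards [H, hGe g] with y h1 h2 using h2.symm.trans h1⟩
    exact h2
  rw [h1]
  exact measurable_measure_prodMk_left hs (measurableSet_singleton 0)

lemma measurable_klLoss (hvy : 0 < vy) (μ : Space p) : Measurable (klLoss vy μ) := by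
  obtain ⟨G, hG, -, hGe⟩ := exists_measurable_version p
  have h : klLoss vy μ = fun g => ∫⁻ y, klPoint (normalDensity vy μ y) (G g y) := by
    funext g
    rw [klLoss_eq_lintegral hvy]
    refine lintegral_congr_ae ?_
    filter_upwards [hGe g] with y hy
    rw [hy]
  rw [h]
  have hm : Measurable fun z : Density p × Space p =>
      klPoint (normalDensity vy μ z.2) (Function.uncurry G z) := by fun_prop
  exact hm.lintegral_prod_right'

lemma risk_tiltAction (hvx : 0 < vx) (hvy : 0 < vy) (Q : Measure (Space p))
    [IsProbabilityMeasure Q] (hQ : HasExpMoments vx Q) (θ : Space p) :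
    risk vx vy θ (Procedure.ofFun _ (measurable_tiltAction hvx hvy Q hQ))
      = predRisk vx vy θ (tiltDensity vx vy Q) := by
  rw [predRisk_eq_lintegral (measurable_tiltDensity Q)]
  refine lintegral_congr fun x => ?_
  congr 1
  change ∫⁻ g, klLoss vy θ g ∂(Kernel.deterministic _ (measurable_tiltAction hvx hvy Q hQ) x) = _
  rw [Kernel.lintegral_deterministic' _ (measurable_klLoss hvy θ), klLoss_eq_lintegral hvy]
  rfl

lemma ofFun_tiltAction_mem_generalizedBayes (hvx : 0 < vx) (hvy : 0 < vy) (Q : Measure (Space p))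
    [IsProbabilityMeasure Q] (hQ : HasExpMoments vx Q) :
    Procedure.ofFun _ (measurable_tiltAction hvx hvy Q hQ) ∈ generalizedBayes p vx vy := by
  refine ⟨untilt vx Q, isPrior_untilt hvx hQ, ae_of_all _ fun x => ?_⟩
  simp_rw [bayesDensity_untilt hvx]
  change ∀ᵐ g ∂(Kernel.deterministic _ (measurable_tiltAction hvx hvy Q hQ) x), _
  rw [Kernel.deterministic_apply, ae_dirac_iff
    (measurableSet_ae_eq (measurable_tiltDensity_right Q x))]
  exact ae_of_all _ fun y => rfl

/-- A Dirac measure charges every set containing its point, measurable or not. -/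
lemma of_ae_dirac {α : Type*} [MeasurableSpace α] {a : α} {P : α → Prop}
    (h : ∀ᵐ b ∂(Measure.dirac a), P b) : P a := by
  by_contra hne
  have h1 := Measure.le_dirac_apply (a := a) (s := {b | ¬ P b})
  rw [ae_iff.1 h, Set.indicator_of_mem (by exact hne)] at h1
  simp at h1

/-! ### Domination -/

/-- The joint law of the observation `x` (under Lebesgue measure), the action drawn by `δ`, and a
point `y` (under Lebesgue measure). -/
def actionMeasure (δ : Procedure p) : Measure ((Space p × Density p) × Space p) :=
  ((volume : Measure (Space p)) ⊗ₘ δ.kernel).prod volume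

lemma lintegral_actionMeasure (δ : Procedure p) (θ : Space p)
    {b : (Space p × Density p) × Space p → ℝ} (hb : Measurable b) :
    ∫⁻ ω, klPoint (normalDensity vy θ ω.2) (b ω) * ENNReal.ofReal (normalDensity vx θ ω.1.1)
        ∂(actionMeasure δ)
      = ∫⁻ x, (∫⁻ g, (∫⁻ y, klPoint (normalDensity vy θ y) (b ((x, g), y))) ∂(δ.kernel x))
          * ENNReal.ofReal (normalDensity vx θ x) := by
  have := δ.isMarkov
  have hm : Measurable fun ω : (Space p × Density p) × Space p =>
      klPoint (normalDensity vy θ ω.2) (b ω) := by fun_prop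
  have hN : Measurable fun ω : (Space p × Density p) × Space p =>
      ENNReal.ofReal (normalDensity vx θ ω.1.1) := by fun_prop
  have hmN : Measurable fun ω : (Space p × Density p) × Space p =>
      klPoint (normalDensity vy θ ω.2) (b ω) * ENNReal.ofReal (normalDensity vx θ ω.1.1) :=
    hm.mul hN
  rw [actionMeasure, lintegral_prod _ hmN.aemeasurable,
    Measure.lintegral_compProd hmN.lintegral_prod_right']
  refine lintegral_congr fun x => ?_
  have hm₂ : Measurable fun g => ∫⁻ y, klPoint (normalDensity vy θ y) (b ((x, g), y)) :=
    (hm.lintegral_prod_right').comp measurable_prodMk_left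
  rw [← lintegral_mul_const _ hm₂]
  refine lintegral_congr fun g => ?_
  exact lintegral_mul_const (ENNReal.ofReal (normalDensity vx θ x))
    (f := fun y => klPoint (normalDensity vy θ y) (b ((x, g), y))) (hm.comp measurable_prodMk_left)

lemma lintegral_actionMeasure_eq_predRisk (δ : Procedure p) (θ : Space p)
    {q : Space p → Space p → ℝ} (hq : Measurable (Function.uncurry q)) :
    ∫⁻ ω, klPoint (normalDensity vy θ ω.2) (q ω.1.1 ω.2)
        * ENNReal.ofReal (normalDensity vx θ ω.1.1) ∂(actionMeasure δ) = predRisk vx vy θ q := by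
  have := δ.isMarkov
  rw [lintegral_actionMeasure δ θ (b := fun ω => q ω.1.1 ω.2)
    (hq.comp ((measurable_fst.comp measurable_fst).prodMk measurable_snd)),
    predRisk_eq_lintegral hq]
  simp

lemma lintegral_actionMeasure_eq_risk (hvy : 0 < vy) (δ : Procedure p) (θ : Space p)
    {G : Density p → Space p → ℝ} (hG : Measurable (Function.uncurry G))
    (hGe : ∀ g : Density p, ∀ᵐ y, G g y = g y) :
    ∫⁻ ω, klPoint (normalDensity vy θ ω.2) (G ω.1.2 ω.2)
        * ENNReal.ofReal (normalDensity vx θ ω.1.1) ∂(actionMeasure δ) = risk vx vy θ δ := by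
  rw [lintegral_actionMeasure δ θ (b := fun ω => G ω.1.2 ω.2)
    (hG.comp ((measurable_snd.comp measurable_fst).prodMk measurable_snd))]
  refine lintegral_congr fun x => ?_
  congr 1
  refine lintegral_congr fun g => ?_
  rw [klLoss_eq_lintegral hvy]
  refine lintegral_congr_ae ?_
  filter_upwards [hGe g] with y hy
  rw [hy]

/-- Functions of the parameter that arise as risks of randomized actions are averaged, under every
finitely supported prior, to at least the Bayes risk; so some Bayes procedure improves on them. -/
lemma exists_tiltDensity_predRisk_le_lintegral (hvx : 0 < vx) (hvy : 0 < vy) (δ : Procedure p)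
    {b : (Space p × Density p) × Space p → ℝ} (hb : Measurable b)
    (hfin : ∃ θ, ∫⁻ ω, klPoint (normalDensity vy θ ω.2) (b ω)
      * ENNReal.ofReal (normalDensity vx θ ω.1.1) ∂(actionMeasure δ) ≠ ∞) :
    ∃ Q : ProbabilityMeasure (Space p), HasExpMoments vx (Q : Measure (Space p)) ∧
      ∀ θ, predRisk vx vy θ (tiltDensity vx vy (Q : Measure (Space p)))
        ≤ ∫⁻ ω, klPoint (normalDensity vy θ ω.2) (b ω)
          * ENNReal.ofReal (normalDensity vx θ ω.1.1) ∂(actionMeasure δ) := by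
  refine exists_tiltDensity_predRisk_le hvx hvy _ hfin fun n s π hπ => ?_
  have h := sum_lintegral_mixDensity_le (actionMeasure δ) hvx hvy s hπ
    (X := fun ω => ω.1.1) (Y := fun ω => ω.2) (by fun_prop) (by fun_prop) hb
  refine le_trans (Finset.sum_le_sum fun j _ => ?_) h
  rw [lintegral_actionMeasure_eq_predRisk δ (s j) (q := mixDensity vx vy s π)
    (measurable_mixDensity s π measurable_fst measurable_snd)]

/-- Averaging the action of `δ` with a nonrandomized action `q` of no larger risk does not increase
the risk. By strict convexity of the loss, the risk stays the same only if `δ` chooses `q`. -/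
lemma midpoint_risk (hvx : 0 < vx) (hvy : 0 < vy) (δ : Procedure p)
    {G : Density p → Space p → ℝ} (hG : Measurable (Function.uncurry G)) (hG0 : ∀ g y, 0 ≤ G g y)
    (hGe : ∀ g : Density p, ∀ᵐ y, G g y = g y) {q : Space p → Space p → ℝ}
    (hqm : Measurable (Function.uncurry q)) (hqpos : ∀ x y, 0 < q x y) (θ : Space p)
    (hqle : predRisk vx vy θ q ≤ risk vx vy θ δ) :
    ∫⁻ ω, klPoint (normalDensity vy θ ω.2) ((G ω.1.2 ω.2 + q ω.1.1 ω.2) / 2)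
        * ENNReal.ofReal (normalDensity vx θ ω.1.1) ∂(actionMeasure δ) ≤ risk vx vy θ δ ∧
      (risk vx vy θ δ ≠ ∞ → risk vx vy θ δ ≤
          ∫⁻ ω, klPoint (normalDensity vy θ ω.2) ((G ω.1.2 ω.2 + q ω.1.1 ω.2) / 2)
            * ENNReal.ofReal (normalDensity vx θ ω.1.1) ∂(actionMeasure δ) →
        ∀ᵐ ω ∂(actionMeasure δ), G ω.1.2 ω.2 = q ω.1.1 ω.2) := by
  have hGm : Measurable fun ω : (Space p × Density p) × Space p => G ω.1.2 ω.2 :=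
    hG.comp ((measurable_snd.comp measurable_fst).prodMk measurable_snd)
  have hqm₂ : Measurable fun ω : (Space p × Density p) × Space p => q ω.1.1 ω.2 :=
    hqm.comp ((measurable_fst.comp measurable_fst).prodMk measurable_snd)
  have hA₀ := lintegral_actionMeasure_eq_risk (vx := vx) hvy δ θ hG hGe
  have hB₀ := lintegral_actionMeasure_eq_predRisk (vx := vx) (vy := vy) δ θ hqm
  have hN : Measurable fun ω : (Space p × Density p) × Space p => normalDensity vy θ ω.2 := by
    fun_prop
  have hNx : Measurable fun ω : (Space p × Density p) × Space p =>
      ENNReal.ofReal (normalDensity vx θ ω.1.1) := by fun_prop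
  obtain ⟨A, hAdef⟩ : ∃ A : (Space p × Density p) × Space p → ℝ≥0∞, A = fun ω =>
    klPoint (normalDensity vy θ ω.2) (G ω.1.2 ω.2) * ENNReal.ofReal (normalDensity vx θ ω.1.1) :=
    ⟨_, rfl⟩
  obtain ⟨B, hBdef⟩ : ∃ B : (Space p × Density p) × Space p → ℝ≥0∞, B = fun ω =>
    klPoint (normalDensity vy θ ω.2) (q ω.1.1 ω.2) * ENNReal.ofReal (normalDensity vx θ ω.1.1) :=
    ⟨_, rfl⟩
  have hA : Measurable A := hAdef ▸ (measurable_klPoint_comp hN hGm).mul hNx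
  have hB : Measurable B := hBdef ▸ (measurable_klPoint_comp hN hqm₂).mul hNx
  have hAB (ω : (Space p × Density p) × Space p) : (A ω + B ω) / 2
      = (klPoint (normalDensity vy θ ω.2) (G ω.1.2 ω.2)
        + klPoint (normalDensity vy θ ω.2) (q ω.1.1 ω.2)) / 2
        * ENNReal.ofReal (normalDensity vx θ ω.1.1) := by
    simp only [hAdef, hBdef, ← add_mul, div_eq_mul_inv]
    ring
  have hUle (ω : (Space p × Density p) × Space p) :
      klPoint (normalDensity vy θ ω.2) ((G ω.1.2 ω.2 + q ω.1.1 ω.2) / 2)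
        * ENNReal.ofReal (normalDensity vx θ ω.1.1) ≤ (A ω + B ω) / 2 := by
    rw [hAB]
    gcongr
    exact klPoint_midpoint_le (normalDensity_pos hvy _ _) (hqpos _ _)
  have hABm : Measurable fun ω => A ω + B ω := hA.add hB
  have hABint : ∫⁻ ω, (A ω + B ω) / 2 ∂(actionMeasure δ) ≤ risk vx vy θ δ := by
    simp_rw [div_eq_mul_inv]
    rw [lintegral_mul_const _ hABm, lintegral_add_left hA, hAdef, hBdef, hA₀, hB₀,
      ← div_eq_mul_inv]
    refine ENNReal.div_le_of_le_mul ?_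
    rw [mul_two]
    gcongr
  refine ⟨(lintegral_mono hUle).trans hABint, fun hfin hge => ?_⟩
  have hae := ae_eq_of_ae_le_of_lintegral_le (ae_of_all _ hUle)
    (((lintegral_mono hUle).trans hABint).trans_lt (lt_top_iff_ne_top.2 hfin)).ne
    (hABm.div_const 2).aemeasurable (hABint.trans hge)
  filter_upwards [hae] with ω hω
  rw [hAB] at hω
  refine eq_of_klPoint_midpoint_eq (normalDensity_pos hvy θ ω.2) (hG0 _ _) (hqpos _ _) ?_
  exact (ENNReal.mul_left_inj (by simpa using normalDensity_pos hvx θ ω.1.1)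
    ENNReal.ofReal_ne_top).1 hω

/-- A procedure of infinite risk everywhere is dominated by the Bayes procedure of the point prior
at `0`, whose risk at `0` vanishes. -/
lemma exists_generalizedBayes_dominates_of_risk_eq_top (hvx : 0 < vx) (hvy : 0 < vy)
    {δ : Procedure p} (hδ : ∀ θ, risk vx vy θ δ = ∞) :
    ∃ (f : Space p → Density p) (hf : Measurable f),
      Procedure.ofFun f hf ∈ generalizedBayes p vx vy ∧
        Dominates vx vy (Procedure.ofFun f hf) δ := by
  have hQ : HasExpMoments vx (Measure.dirac (0 : Space p)) := fun x =>
    integrable_dirac (by finiteness)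
  refine ⟨_, measurable_tiltAction hvx hvy _ hQ,
    ofFun_tiltAction_mem_generalizedBayes hvx hvy _ hQ, fun θ => (hδ θ).symm ▸ le_top, 0, ?_⟩
  have h : ∀ x y : Space p,
      tiltDensity vx vy (Measure.dirac (0 : Space p)) x y = normalDensity vy 0 y := fun x y => by
    simp [tiltDensity, integral_dirac]
  rw [risk_tiltAction, hδ, predRisk]
  simp [h, klPoint_self (normalDensity_pos hvy _ _)]

/-- Every procedure that is not generalized Bayes is dominated by a nonrandomized generalized Bayes
procedure. -/
theorem exists_generalizedBayes_dominates (hvx : 0 < vx) (hvy : 0 < vy) {δ : Procedure p}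
    (hδ : δ ∉ generalizedBayes p vx vy) :
    ∃ (f : Space p → Density p) (hf : Measurable f),
      Procedure.ofFun f hf ∈ generalizedBayes p vx vy ∧
        Dominates vx vy (Procedure.ofFun f hf) δ := by
  have := δ.isMarkov
  by_cases hfin : ∃ θ, risk vx vy θ δ ≠ ∞
  swap
  · push Not at hfin
    exact exists_generalizedBayes_dominates_of_risk_eq_top hvx hvy hfin
  obtain ⟨G, hG, hG0, hGe⟩ := exists_measurable_version p
  have hriskG (θ : Space p) := lintegral_actionMeasure_eq_risk (vx := vx) hvy δ θ hG hGe
  have hGm : Measurable fun ω : (Space p × Density p) × Space p => G ω.1.2 ω.2 :=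
    hG.comp ((measurable_snd.comp measurable_fst).prodMk measurable_snd)
  obtain ⟨Q, hQ, hQle⟩ := exists_tiltDensity_predRisk_le_lintegral hvx hvy δ hGm
    (by simpa only [hriskG] using hfin)
  simp only [hriskG] at hQle
  have hqm : Measurable (Function.uncurry (tiltDensity vx vy (Q : Measure (Space p)))) :=
    measurable_tiltDensity _
  have hmid (θ : Space p) := midpoint_risk hvx hvy δ hG hG0 hGe hqm
    (tiltDensity_pos hvx hvy hQ) θ (hQle θ)
  have hb : Measurable fun ω : (Space p × Density p) × Space p =>
      (G ω.1.2 ω.2 + tiltDensity vx vy (Q : Measure (Space p)) ω.1.1 ω.2) / 2 :=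
    (hGm.add (hqm.comp ((measurable_fst.comp measurable_fst).prodMk measurable_snd))).div_const 2
  by_cases hstrict : ∃ θ, ∫⁻ ω, klPoint (normalDensity vy θ ω.2)
      ((G ω.1.2 ω.2 + tiltDensity vx vy (Q : Measure (Space p)) ω.1.1 ω.2) / 2)
        * ENNReal.ofReal (normalDensity vx θ ω.1.1) ∂(actionMeasure δ) < risk vx vy θ δ
  · -- The averaged action strictly improves on `δ`, and a Bayes procedure improves on the former.
    obtain ⟨θ, hθ⟩ := hstrict
    obtain ⟨R, hR, hRle⟩ := exists_tiltDensity_predRisk_le_lintegral hvx hvy δ hb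
      ⟨θ, (hθ.trans_le le_top).ne⟩
    refine ⟨_, measurable_tiltAction hvx hvy _ hR,
      ofFun_tiltAction_mem_generalizedBayes hvx hvy _ hR, fun ϑ => ?_, θ, ?_⟩
    · rw [risk_tiltAction]
      exact (hRle ϑ).trans (hmid ϑ).1
    · rw [risk_tiltAction]
      exact (hRle θ).trans_lt hθ
  · exfalso
    push Not at hstrict
    obtain ⟨θ, hθ⟩ := hfin
    have hGq := (hmid θ).2 hθ (hstrict θ)
    refine hδ ⟨untilt vx Q, isPrior_untilt hvx hQ, ?_⟩
    filter_upwards [Measure.ae_ae_of_ae_compProd (Measure.ae_ae_of_ae_prod hGq)] with x hx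
    filter_upwards [hx] with g hg
    filter_upwards [hg, hGe g] with y hy hy'
    rw [bayesDensity_untilt hvx, ← hy', hy]

end PredictiveDensity

end

theorem theorem5 (p : ℕ) (vx vy : ℝ) (hvx : 0 < vx) (hvy : 0 < vy) :
    PredictiveDensity.IsCompleteClass vx vy Set.univ
      (PredictiveDensity.generalizedBayes p vx vy) ∧
    PredictiveDensity.IsCompleteClass vx vy (PredictiveDensity.nonrandomized p)
      (PredictiveDensity.nonrandomized p ∩ PredictiveDensity.generalizedBayes p vx vy) ∧
    (∀ δ : PredictiveDensity.Procedure p,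
      PredictiveDensity.IsAdmissible vx vy Set.univ δ →
        ∃ M : MeasureTheory.Measure (PredictiveDensity.Space p),
          PredictiveDensity.IsPrior vx M ∧
          ∀ᵐ x, ∀ᵐ g ∂(δ.kernel x), ∀ᵐ y, g y = PredictiveDensity.bayesDensity vx vy M x y) ∧
    (∀ (f : PredictiveDensity.Space p → PredictiveDensity.Density p) (hf : Measurable f),
      PredictiveDensity.IsAdmissible vx vy (PredictiveDensity.nonrandomized p)
          (PredictiveDensity.Procedure.ofFun f hf) →
        ∃ M : MeasureTheory.Measure (PredictiveDensity.Space p),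
          PredictiveDensity.IsPrior vx M ∧
          ∀ᵐ x, ∀ᵐ y, f x y = PredictiveDensity.bayesDensity vx vy M x y) := by
  refine ⟨⟨Set.subset_univ _, fun δ _ hδ => ?_⟩, ⟨Set.inter_subset_left, fun δ hδD hδ => ?_⟩,
    fun δ hadm => ?_, fun f hf hadm => ?_⟩
  · obtain ⟨f, hf, hmem, hdom⟩ :=
      PredictiveDensity.exists_generalizedBayes_dominates hvx hvy hδ
    exact ⟨_, hmem, hdom⟩
  · obtain ⟨f, hf, hmem, hdom⟩ :=
      PredictiveDensity.exists_generalizedBayes_dominates hvx hvy fun h => hδ ⟨hδD, h⟩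
    exact ⟨_, ⟨⟨f, hf, rfl⟩, hmem⟩, hdom⟩
  · by_contra hδ
    obtain ⟨f, hf, -, hdom⟩ := PredictiveDensity.exists_generalizedBayes_dominates hvx hvy hδ
    exact hadm.2 _ (Set.mem_univ _) hdom
  · have hmem : PredictiveDensity.Procedure.ofFun f hf ∈
        PredictiveDensity.generalizedBayes p vx vy := by
      by_contra hδ
      obtain ⟨f', hf', -, hdom⟩ := PredictiveDensity.exists_generalizedBayes_dominates hvx hvy hδ
      exact hadm.2 _ ⟨f', hf', rfl⟩ hdom
    obtain ⟨M, hM, hae⟩ := hmem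
    refine ⟨M, hM, hae.mono fun x hx => ?_⟩
    have hx' : ∀ᵐ g ∂(Kernel.deterministic f hf x),
        ∀ᵐ y, g y = PredictiveDensity.bayesDensity vx vy M x y := hx
    rw [Kernel.deterministic_apply] at hx'
    exact PredictiveDensity.of_ae_dirac (a := f x)
      (P := fun g => ∀ᵐ y, g y = PredictiveDensity.bayesDensity vx vy M x y) hx'
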